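/- Consider a platoon of $N$ follower vehicles $i\in\{1,\dots,N\}$ behind a leader (vehicle $0$) of constant speed $v_0$ and position $s_0(t)=s_0+t\,\Delta t\,v_0$, $\Delta t>0$. Follower $i$ has state $x_i=(s_i,v_i,T_i)$, output $y_i=(s_i,v_i)$, and dynamics $$s_i(t+1)=s_i+v_i\Delta t,\quad v_i(t+1)=v_i+\tfrac{\Delta t}{m_i}\bigl(\tfrac{\eta_i}{r_i}T_i-C_{A,i}v_i^2-m_i g f_i\bigr),\quad T_i(t+1)=T_i-\tfrac{\Delta t}{\tau_i}T_i+\tfrac{\Delta t}{\tau_i}u_i ,$$ with $m_i,\tau_i,r_i,\eta_i>0$. Put $h_i(v)=\frac{r_i}{\eta_i}(C_{A,i}v^2+m_i g f_i)$ and let $x_{\mathrm{des},i}(t)=(s_0(t)-i\,d,\;v_0,\;h_i(v_0))$, with output $y_{\mathrm{des},i}(t)$, be the desired motion. Let $\mathbb N_i$ and $\mathbb O_i$ be the sets of followers from which $i$ receives, respectively to which $i$ sends, information; put $p_i=1$ if $i$ receives information from the leader and $p_i=0$ otherwise, and $\mathbb I_i=\mathbb N_i\cup\{0\}$ if $p_i=1$,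 $\mathbb I_i=\mathbb N_i$ if $p_i=0$. The topology is unidirectional ($j\in\mathbb N_i$ implies $j<i$), and the communication graph contains a spanning tree rooted at the leader. Let $\tilde d_{i,j}=((i-j)d,0)^\top$, let $\varepsilon>0$, let the prediction horizon satisfy $N_p\ge 3$, and assume $u_{\min,i}<h_i(v_0)<u_{\max,i}$ for all $i$. Write $\|x\|_A=x^\top A x$, and $A\succeq_\varepsilon 0$ if $A$ is symmetric with all eigenvalues at least $\varepsilon$. At each time $t$, given the current states and the assumed outputs $y_j^a(k|t)$, $0\le k\le N_p$ (with $y_0^a(k|t)=(s_0(t+k),v_0)$ for the leader), every follower $i$ minimizes, over its predicted inputs $u_i^p(0|t),\dots,u_i^p(N_p-1|t)$ and its weights $Q_i,\Theta_i,F_i,G_i\in\mathbb R^{2\times2}$, $R_i\in\mathbb R$, the cost $$J_i=\sum_{k=0}^{N_p-1}\Bigl(\|y_i^p(k|t)-y_{\mathrm{des},i}(t+k)\|_{Q_i}+R_i\bigl(u_i^p(k|t)-h_i(v_i^p(k|t))\bigr)^2+\|y_i^p(k|t)-y_i^a(k|t)\|_{F_i}+\sum_{j\in\mathbb N_i}\|y_i^p(k|t)-y_j^a(k|t)+\tilde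 d_{i,j}\|_{G_i}\Bigr)$$ subject to: the predicted motion follows the dynamics from $x_i^p(0|t)=x_i(t)$; $u_i^p(k|t)\in[u_{\min,i},u_{\max,i}]$; $y_i^p(N_p|t)=\frac1{|\mathbb I_i|}\sum_{j\in\mathbb I_i}(y_j^a(N_p|t)-\tilde d_{i,j})$; $T_i^p(N_p|t)=h_i(v_i^p(N_p|t))$; $Q_i=\Theta_i$, with $\Theta_i\succeq_\varepsilon0$ if $p_i=1$ and $Q_i=0$ if $p_i=0$; $R_i\ge\varepsilon$; $G_i\succeq_\varepsilon0$ if $\mathbb N_i\ne\varnothing$ and $G_i=0$ otherwise; $F_i\succeq_\varepsilon0$ if $\mathbb O_i=\varnothing$ and $F_i-\sum_{j\in\mathbb O_i}G_j\succeq0$ otherwise (where the $G_j$, $j\ne i$, are the weights chosen by the other vehicles at the same time). A joint solution is a choice, for all vehicles, of minimizers of these coupled problems. Each vehicle applies $u_i^p(0|t)$ of some joint solution, and $y_i^a(k|t+1)=y_i^p(k+1|t)$ for $0\le k\le N_p$, where the prediction is continued one step beyond the horizon with the input $h_i(v_i^p(N_p|t))$. The initial states and the initial assumed outputs are arbitrary.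 Then the platoon under this controller is asymptotically stable. That is, measuring the deviation of all $x_i(t)$ from $x_{\mathrm{des},i}(t)$ and of all $y_i^a(k|t)$ from $y_{\mathrm{des},i}(t+k)$, $0\le k\le N_p$: 1. there is $\delta>0$ such that a closed-loop motion with initial deviation less than $\delta$ never reaches a state at which the optimization problems have no joint solution; 2. for every $e>0$ there is $\delta>0$ such that a closed-loop motion with initial deviation less than $\delta$ has deviation less than $e$ at all times at which it is defined; 3. the deviation of every closed-loop motion defined for all times tends to $0$. -/

import Mathlib

open scoped Matrix

namespace Platooning

/-- State `(s, v, T)` of a vehicle: position, velocity, integrated driving/braking torque. -/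
abbrev State := Fin 3 → ℝ

/-- Output `(s, v)` of a vehicle. -/
abbrev Output := Fin 2 → ℝ

/-- Weight matrices acting on outputs. -/
abbrev Weight := Matrix (Fin 2) (Fin 2) ℝ

/-- Physical parameters of a follower vehicle: mass `m`, aerodynamic drag coefficient `CA`,
rolling resistance coefficient `f`, inertial lag `τ`, tire radius `r`, driveline efficiency `η`,
and the bounds `umin`, `umax` of the control input. -/
structure Vehicle where
  m : ℝ
  CA : ℝ
  f : ℝ
  τ : ℝ
  r : ℝ
  η : ℝ
  umin : ℝ
  umax : ℝ
  m_pos : 0 < m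
  τ_pos : 0 < τ
  r_pos : 0 < r
  η_pos : 0 < η

/-- A heterogeneous platoon of `N` followers behind a leader of constant speed `v0`.
The element `i : Fin N` is the follower number `i + 1`.  `adj i j` means that follower `j` sends
information to follower `i`; `pinned i` means that `i` receives information from the leader.
`dt` is the time step, `g` the gravity constant, `s0` the leader's position at time `0`, `d` the
desired gap between consecutive vehicles, `Np` the prediction horizon, and `ε` the lower bound
for the weights. -/
structure Platoon (N : ℕ) where
  veh : Fin N → Vehicle
  adj : Fin N → Fin N → Prop
  pinned : Fin N → Prop
  dt : ℝ
  g : ℝ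
  s0 : ℝ
  v0 : ℝ
  d : ℝ
  Np : ℕ
  ε : ℝ
  dt_pos : 0 < dt
  ε_pos : 0 < ε

/-- The quadratic form `xᵀ A x` (written `‖x‖_A` in the platooning literature, without a root). -/
def wnorm (A : Weight) (x : Output) : ℝ := x ⬝ᵥ (A *ᵥ x)

/-- `A ⪰_ε 0`: `A` is symmetric and `xᵀ A x ≥ ε xᵀ x` for all `x`, i.e. all eigenvalues are
at least `ε`. -/
def EpsPosDef (ε : ℝ) (A : Weight) : Prop :=
  A.IsSymm ∧ ∀ x : Output, ε * (x ⬝ᵥ x) ≤ wnorm A x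

/-- The output matrix. -/
def gam : Matrix (Fin 2) (Fin 3) ℝ := !![1, 0, 0; 0, 1, 0]

namespace Platoon

variable {N : ℕ} (P : Platoon N)

/-! ### Communication topology; the vertex `none` is the leader -/

/-- `P.Edge a i`: vehicle `a` sends information to follower `i`. -/
def Edge (a : Option (Fin N)) (i : Fin N) : Prop :=
  match a with
  | none => P.pinned i
  | some j => P.adj i j

open Classical in
/-- `ℕ_i`: followers from which `i` gets information. -/
noncomputable def inNbrs (i : Fin N) : Finset (Fin N) := {j | P.adj i j}

open Classical in
/-- `𝕆_i`: followers to which `i` sends information. -/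
noncomputable def outNbrs (i : Fin N) : Finset (Fin N) := {j | P.adj j i}

open Classical in
/-- `𝕀_i`: all vehicles, possibly including the leader, from which `i` gets information. -/
noncomputable def sources (i : Fin N) : Finset (Option (Fin N)) := {a | P.Edge a i}

/-- Unidirectional topology: information only flows from a vehicle to vehicles behind it. -/
def Unidirectional : Prop := ∀ i j, P.adj i j → j < i

/-- The communication graph contains a directed spanning tree rooted at the leader: each follower
can be given a parent along an edge of the graph such that the tree edges lead from the leader
to every follower. -/
def HasSpanningTree : Prop :=
  ∃ parent : Fin N → Option (Fin N),
    (∀ i, P.Edge (parent i) i) ∧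
    ∀ i, Relation.ReflTransGen (fun a b => ∃ j, b = some j ∧ parent j = a) none (some i)

/-! ### Vehicle dynamics -/

/-- Resistance force `Γ_i(v)`. -/
def resist (i : Fin N) (v : ℝ) : ℝ :=
  (P.veh i).CA * v ^ 2 + (P.veh i).m * P.g * (P.veh i).f

/-- External drag `h_i(v)`: the torque (and input) of steady motion at speed `v`. -/
noncomputable def drag (i : Fin N) (v : ℝ) : ℝ :=
  ((P.veh i).r / (P.veh i).η) * ((P.veh i).CA * v ^ 2 + (P.veh i).m * P.g * (P.veh i).f)

/-- Drift `φ_i`. -/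
noncomputable def phi (i : Fin N) (x : State) : State :=
  ![x 0 + x 1 * P.dt,
    x 1 + P.dt / (P.veh i).m * ((P.veh i).η / (P.veh i).r * x 2 - P.resist i (x 1)),
    x 2 - 1 / (P.veh i).τ * x 2 * P.dt]

/-- Input vector `ψ_i`. -/
noncomputable def psi (i : Fin N) : State := ![0, 0, 1 / (P.veh i).τ * P.dt]

/-- One time step of vehicle `i` under input `u`. -/
noncomputable def dyn (i : Fin N) (x : State) (u : ℝ) : State := P.phi i x + u • P.psi i

/-! ### Desired motion -/

/-- Position in the string: the leader is `0`, followers are `1, …, N`. -/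
def num (a : Option (Fin N)) : ℝ :=
  match a with
  | none => 0
  | some j => (j : ℝ) + 1

/-- Output of the leader at time `t`. -/
def leader (t : ℕ) : Output := ![P.s0 + t * P.dt * P.v0, P.v0]

/-- Desired state of follower `i` at time `t`. -/
noncomputable def des (i : Fin N) (t : ℕ) : State :=
  ![P.leader t 0 - num (some i) * P.d, P.v0, P.drag i P.v0]

/-- `(d_{i,a}, 0)`, where `d_{i,a}` is the desired distance by which `i` is behind `a`. -/
def gap (i : Fin N) (a : Option (Fin N)) : Output := ![(num (some i) - num a) * P.d, 0]

/-! ### The closed loop -/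

/-- State of the closed loop at one time: the vehicle states `x_i` and the assumed
outputs `y_i^a(k)`, `0 ≤ k ≤ Np` (the values at `k > Np` are irrelevant). -/
structure LoopState (N : ℕ) where
  x : Fin N → State
  ya : Fin N → ℕ → Output

/-- The variables of one vehicle's optimization problem. -/
structure Decision (Np : ℕ) where
  u : Fin Np → ℝ
  Q : Weight
  Θ : Weight
  R : ℝ
  F : Weight
  G : Weight

/-- Predicted states `x_i^p(k)` from `x` under the inputs `u`; past the horizon the steady input
`h_i(v)` is applied. -/
noncomputable def pred (i : Fin N) (x : State) (u : Fin P.Np → ℝ) : ℕ → State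
  | 0 => x
  | k + 1 =>
    let z := pred i x u k
    P.dyn i z (if hk : k < P.Np then u ⟨k, hk⟩ else P.drag i (z 1))

/-- Output that vehicle `a` is assumed to have at time `t + k`; for the leader it is the
actual one. -/
def assumed (t : ℕ) (S : LoopState N) (a : Option (Fin N)) (k : ℕ) : Output :=
  match a with
  | none => P.leader (t + k)
  | some j => S.ya j k

open Classical in
/-- Cost `J_i` at time `t`. -/
noncomputable def cost (t : ℕ) (S : LoopState N) (i : Fin N) (w : Decision P.Np) : ℝ :=
  ∑ k : Fin P.Np,
    let z := P.pred i (S.x i) w.u k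
    let y := gam *ᵥ z
    (wnorm w.Q (y - gam *ᵥ P.des i (t + k))
      + w.R * (w.u k - P.drag i (z 1)) ^ 2
      + wnorm w.F (y - S.ya i k)
      + ∑ j ∈ P.inNbrs i, wnorm w.G (y - S.ya j k + P.gap i (some j)))

/-- Constraints on the inputs of vehicle `i` at time `t`: bounds, and the two terminal conditions.
(The dynamics and the initial state are built into `pred`.) -/
def InputFeasible (t : ℕ) (S : LoopState N) (i : Fin N) (u : Fin P.Np → ℝ) : Prop :=
  (∀ k, u k ∈ Set.Icc (P.veh i).umin (P.veh i).umax) ∧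
  gam *ᵥ P.pred i (S.x i) u P.Np =
    (1 / ((P.sources i).card : ℝ)) •
      ∑ a ∈ P.sources i, (P.assumed t S a P.Np - P.gap i a) ∧
  P.pred i (S.x i) u P.Np 2 = P.drag i (P.pred i (S.x i) u P.Np 1)

/-- Constraints on the weights of vehicle `i`, given the weights `G_j` of the other vehicles. -/
def WeightFeasible (G : Fin N → Weight) (i : Fin N) (w : Decision P.Np) : Prop :=
  (P.pinned i → EpsPosDef P.ε w.Θ) ∧
  (¬ P.pinned i → w.Q = 0) ∧
  w.Q - w.Θ = 0 ∧
  P.ε ≤ w.R ∧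
  ((P.inNbrs i).Nonempty → EpsPosDef P.ε w.G) ∧
  (P.inNbrs i = ∅ → w.G = 0) ∧
  (P.outNbrs i = ∅ → EpsPosDef P.ε w.F) ∧
  ((P.outNbrs i).Nonempty → (w.F - ∑ j ∈ P.outNbrs i, G j).PosSemidef)

/-- Feasible set of vehicle `i`'s metric-learning problem at time `t`. -/
def Feasible (t : ℕ) (S : LoopState N) (G : Fin N → Weight) (i : Fin N)
    (w : Decision P.Np) : Prop :=
  P.InputFeasible t S i w.u ∧ P.WeightFeasible G i w

/-- `W` is a joint solution at time `t`: for every vehicle `i`, `W i` minimizes `J_i` over the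
feasible set of vehicle `i`, in which the matrices `G_j` are those of the other vehicles. -/
def IsSolution (t : ℕ) (S : LoopState N) (W : Fin N → Decision P.Np) : Prop :=
  ∀ i, P.Feasible t S (fun j => (W j).G) i (W i) ∧
    ∀ w, P.Feasible t S (fun j => (W j).G) i w → P.cost t S i (W i) ≤ P.cost t S i w

/-- Successor state: every vehicle applies the first input of its plan, and the new assumed
output is the shifted predicted one, continued by steady motion. -/
noncomputable def next (S : LoopState N) (W : Fin N → Decision P.Np) : LoopState N where
  x i := P.dyn i (S.x i) (if h0 : 0 < P.Np then (W i).u ⟨0, h0⟩ else P.drag i (S.x i 1))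
  ya i k := gam *ᵥ P.pred i (S.x i) (W i).u (k + 1)

/-- The closed loop can move from `S` at time `t` to `S'` at time `t + 1`. -/
def Step (t : ℕ) (S S' : LoopState N) : Prop :=
  ∃ W, P.IsSolution t S W ∧ S' = P.next S W

/-- The closed-loop state `S` at time `t` is closer than `e` to the desired motion. -/
def Near (e : ℝ) (t : ℕ) (S : LoopState N) : Prop :=
  ∀ i, ‖S.x i - P.des i t‖ < e ∧
    ∀ k ≤ P.Np, ‖S.ya i k - gam *ᵥ P.des i (t + k)‖ < e

/-- Local well-posedness: closed-loop motions that start near the desired motion never reach a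
state at which the optimization problems have no solution. -/
def RecursivelySolvable : Prop :=
  ∃ δ > 0, ∀ (S : ℕ → LoopState N) (n : ℕ), P.Near δ 0 (S 0) →
    (∀ t < n, P.Step t (S t) (S (t + 1))) → ∃ W, P.IsSolution n (S n) W

/-- Lyapunov stability of the desired motion. -/
def LyapunovStable : Prop :=
  ∀ e > 0, ∃ δ > 0, ∀ (S : ℕ → LoopState N) (n : ℕ), P.Near δ 0 (S 0) →
    (∀ t < n, P.Step t (S t) (S (t + 1))) → P.Near e n (S n)

/-- Every closed-loop motion converges to the desired motion. -/
def Attractive : Prop :=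
  ∀ S : ℕ → LoopState N, (∀ t, P.Step t (S t) (S (t + 1))) →
    ∀ e > 0, ∀ᶠ t in Filter.atTop, P.Near e t (S t)

/-- Asymptotic stability of the platoon under the metric-learning controller. -/
def AsymptoticallyStable : Prop :=
  P.RecursivelySolvable ∧ P.LyapunovStable ∧ P.Attractive

end Platoon

end Platooning

/-! Measured relative to the desired motion, the gaps drop out, each terminal condition says that
the plan ends at the mean of the sources' assumed terminal errors, and positions integrate velocity
errors. Five observations carry the proof.

The learned weights can be eliminated. Replacing all weights of vehicle `i` except `F` by the
smallest admissible ones keeps feasibility and cannot raise the cost, so optimal inputs minimize ε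
times a cost with unit weights plus the tracking cost of `F` (`IsSolution.le`). Also F ⪰ ε, because
F dominates a nonempty sum of matrices G_j (`WeightFeasible.epsPosDef_F`). If every vehicle takes
minimal weights the coupling disappears, so joint solutions exist whenever the input constraints are
feasible (`exists_isSolution`).

Near the desired motion the input constraints are feasible: a motion is parametrized by its
velocities, and three free steps reach any nearby terminal output (`exists_steering`). Comparison
with such a plan keeps optimal plans small (`IsSolution.abs_err_le`). The difficulty is that F has
no upper bound and may be relatively degenerate; the position recursion with small end positions
compensates (`abs_position_le`).

Since information flows only backwards, terminal errors vanish vehicle by vehicle within N steps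
(`Run.aerr_eq_zero`). From then on the shifted previous plan is feasible and has no tracking cost,
whatever F is. This bounds the next unit-weight cost plus deviation by the current unit-weight cost,
up to deviations of predecessors (`Run.baseCost_succ_le`).

This inequality alone gives no contraction. But a plan with zero terminal error behaves like a shift
register that empties itself, so its exponentially weighted size contracts up to the deviation
(`Run.planSize_succ_le`), and it bounds the unit-weight cost up to predecessors, because excess
inputs are controlled by output errors once velocities are bounded (`exists_res_bound`,
`exists_baseCost_bound`).

A combination of cost, size and deviation therefore contracts up to predecessors
(`exists_vehLyap_succ_le`), and geometric weights along the string absorb this triangular coupling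
(`exists_lyap_succ_le`). Continuous dependence over the first N + 1 steps (`exists_near_of_near`)
supplies the small initial value that stability needs. -/

namespace Platooning

namespace Platoon

/-! ### Vehicle dynamics and predictions in coordinates. -/

section

variable {N : ℕ} (P : Platoon N)

/-- Gain from excess torque to velocity increment. -/
noncomputable def gain (i : Fin N) : ℝ := P.dt * (P.veh i).η / ((P.veh i).m * (P.veh i).r)

lemma gain_pos (i : Fin N) : 0 < P.gain i := by
  have := P.dt_pos
  have := (P.veh i).m_pos
  have := (P.veh i).r_pos
  have := (P.veh i).η_pos
  unfold gain
  positivity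

lemma dyn_zero (i : Fin N) (x : State) (u : ℝ) : P.dyn i x u 0 = x 0 + P.dt * x 1 := by
  simp [dyn, phi, psi]
  ring

lemma dyn_one (i : Fin N) (x : State) (u : ℝ) :
    P.dyn i x u 1 = x 1 + P.gain i * (x 2 - P.drag i (x 1)) := by
  have hm := (P.veh i).m_pos.ne'
  have hr := (P.veh i).r_pos.ne'
  have hη := (P.veh i).η_pos.ne'
  simp [dyn, phi, psi, gain, drag, resist]
  field_simp

lemma dyn_two (i : Fin N) (x : State) (u : ℝ) :
    P.dyn i x u 2 = x 2 + P.dt / (P.veh i).τ * (u - x 2) := by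
  simp [dyn, phi, psi]
  ring

/-- Excess of the `k`-th planned input over the drag at the predicted velocity; it vanishes past
the horizon. -/
noncomputable def res (i : Fin N) (x : State) (u : Fin P.Np → ℝ) (k : ℕ) : ℝ :=
  (if hk : k < P.Np then u ⟨k, hk⟩ else P.drag i (P.pred i x u k 1)) - P.drag i (P.pred i x u k 1)

lemma res_of_lt (i : Fin N) (x : State) (u : Fin P.Np → ℝ) (k : Fin P.Np) :
    P.res i x u k = u k - P.drag i (P.pred i x u k 1) := by
  simp [res]

lemma res_of_le (i : Fin N) (x : State) (u : Fin P.Np → ℝ) {k : ℕ} (hk : P.Np ≤ k) :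
    P.res i x u k = 0 := by
  simp [res, hk.not_gt]

lemma pred_zero (i : Fin N) (x : State) (u : Fin P.Np → ℝ) : P.pred i x u 0 = x := rfl

lemma pred_succ (i : Fin N) (x : State) (u : Fin P.Np → ℝ) (k : ℕ) :
    P.pred i x u (k + 1) =
      P.dyn i (P.pred i x u k) (P.res i x u k + P.drag i (P.pred i x u k 1)) := by
  rw [res, sub_add_cancel]
  rfl

lemma pred_succ_zero (i : Fin N) (x : State) (u : Fin P.Np → ℝ) (k : ℕ) :
    P.pred i x u (k + 1) 0 = P.pred i x u k 0 + P.dt * P.pred i x u k 1 := by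
  rw [pred_succ, dyn_zero]

lemma pred_succ_one (i : Fin N) (x : State) (u : Fin P.Np → ℝ) (k : ℕ) :
    P.pred i x u (k + 1) 1 = P.pred i x u k 1 +
      P.gain i * (P.pred i x u k 2 - P.drag i (P.pred i x u k 1)) := by
  rw [pred_succ, dyn_one]

lemma pred_succ_two (i : Fin N) (x : State) (u : Fin P.Np → ℝ) (k : ℕ) :
    P.pred i x u (k + 1) 2 = P.pred i x u k 2 + P.dt / (P.veh i).τ *
      (P.res i x u k + P.drag i (P.pred i x u k 1) - P.pred i x u k 2) := by
  rw [pred_succ, dyn_two]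

/-- The torque is determined by two consecutive velocities. -/
lemma pred_torque (i : Fin N) (x : State) (u : Fin P.Np → ℝ) (k : ℕ) :
    P.pred i x u k 2 = P.drag i (P.pred i x u k 1) +
      (P.pred i x u (k + 1) 1 - P.pred i x u k 1) / P.gain i := by
  have := (P.gain_pos i).ne'
  rw [pred_succ_one]
  field_simp
  ring

/-- The excess input is determined by two consecutive torques and the velocity. -/
lemma res_eq (i : Fin N) (x : State) (u : Fin P.Np → ℝ) (k : ℕ) :
    P.res i x u k = P.pred i x u k 2 - P.drag i (P.pred i x u k 1) +
      (P.veh i).τ / P.dt * (P.pred i x u (k + 1) 2 - P.pred i x u k 2) := by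
  have h1 := (P.veh i).τ_pos.ne'
  have h2 := P.dt_pos.ne'
  rw [pred_succ_two]
  field_simp
  ring

lemma drag_sub (i : Fin N) (v w : ℝ) :
    P.drag i v - P.drag i w =
      (P.veh i).r / (P.veh i).η * (P.veh i).CA * (v + w) * (v - w) := by
  unfold drag
  ring

lemma continuous_drag (i : Fin N) : Continuous (P.drag i) := by
  unfold drag
  fun_prop

lemma gam_mulVec_zero (x : State) : (gam *ᵥ x) 0 = x 0 := by
  simp [gam, Matrix.mulVec, dotProduct, Fin.sum_univ_three]

lemma gam_mulVec_one (x : State) : (gam *ᵥ x) 1 = x 1 := by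
  simp [gam, Matrix.mulVec, dotProduct, Fin.sum_univ_three]

lemma des_one (i : Fin N) (t : ℕ) : P.des i t 1 = P.v0 := rfl

lemma des_two (i : Fin N) (t : ℕ) : P.des i t 2 = P.drag i P.v0 := rfl

lemma des_succ_zero (i : Fin N) (t : ℕ) : P.des i (t + 1) 0 = P.des i t 0 + P.dt * P.v0 := by
  simp [des, leader]
  ring

/-! ### Constraints and cost in error coordinates. -/

/-- Predicted output error of vehicle `i`, `k` steps after time `t`. -/
noncomputable def err (i : Fin N) (t : ℕ) (x : State) (u : Fin P.Np → ℝ) (k : ℕ) : Output :=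
  gam *ᵥ P.pred i x u k - gam *ᵥ P.des i (t + k)

/-- Assumed output error of vehicle `i`, `k` steps after time `t`. -/
noncomputable def aerr (t : ℕ) (S : LoopState N) (i : Fin N) (k : ℕ) : Output :=
  S.ya i k - gam *ᵥ P.des i (t + k)

lemma err_zero (i : Fin N) (t : ℕ) (x : State) (u : Fin P.Np → ℝ) (k : ℕ) :
    P.err i t x u k 0 = P.pred i x u k 0 - P.des i (t + k) 0 := by
  simp [err, gam_mulVec_zero]

lemma err_one (i : Fin N) (t : ℕ) (x : State) (u : Fin P.Np → ℝ) (k : ℕ) :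
    P.err i t x u k 1 = P.pred i x u k 1 - P.v0 := by
  simp [err, gam_mulVec_one, des_one]

lemma err_succ_zero (i : Fin N) (t : ℕ) (x : State) (u : Fin P.Np → ℝ) (k : ℕ) :
    P.err i t x u (k + 1) 0 = P.err i t x u k 0 + P.dt * P.err i t x u k 1 := by
  rw [err_zero, err_zero, err_one, pred_succ_zero, ← add_assoc, des_succ_zero]
  ring

lemma output_sub_add_gap (i j : Fin N) (t : ℕ) (S : LoopState N) (x : State)
    (u : Fin P.Np → ℝ) (k : ℕ) :
    gam *ᵥ P.pred i x u k - S.ya j k + P.gap i (some j) =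
      P.err i t x u k - P.aerr t S j k := by
  ext l
  fin_cases l
  · simp [err, aerr, gap, gam_mulVec_zero, des]
    ring
  · simp [err, aerr, gap, gam_mulVec_one, des]

/-- Assumed output error of a source, which is zero for the leader. -/
noncomputable def srcErr (t : ℕ) (S : LoopState N) (a : Option (Fin N)) (k : ℕ) : Output :=
  match a with
  | none => 0
  | some j => P.aerr t S j k

lemma assumed_sub_gap (i : Fin N) (t : ℕ) (S : LoopState N) (a : Option (Fin N)) (k : ℕ) :
    P.assumed t S a k - P.gap i a = P.srcErr t S a k + gam *ᵥ P.des i (t + k) := by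
  ext l
  cases a <;> fin_cases l
  · simp [srcErr, assumed, gap, gam_mulVec_zero, des, num]
  · simp [srcErr, assumed, gap, gam_mulVec_one, des, leader]
  · simp [srcErr, aerr, assumed, gap, gam_mulVec_zero, des]
    ring
  · simp [srcErr, aerr, assumed, gap, gam_mulVec_one, des]

lemma sources_nonempty (htree : P.HasSpanningTree) (i : Fin N) : (P.sources i).Nonempty := by
  obtain ⟨par, h, -⟩ := htree
  exact ⟨par i, by simpa [sources] using h i⟩

/-- Mean of the assumed terminal errors of the sources of `i`. -/
noncomputable def target (t : ℕ) (S : LoopState N) (i : Fin N) : Output :=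
  (1 / ((P.sources i).card : ℝ)) • ∑ a ∈ P.sources i, P.srcErr t S a P.Np

/-- Each source contributes its error plus the same desired output of `i`, so averaging returns that
output. The tree provides a source, which makes the mean a genuine one. -/
lemma inputFeasible_iff (htree : P.HasSpanningTree) (t : ℕ) (S : LoopState N) (i : Fin N)
    (u : Fin P.Np → ℝ) :
    P.InputFeasible t S i u ↔
      (∀ k, u k ∈ Set.Icc (P.veh i).umin (P.veh i).umax) ∧
      P.err i t (S.x i) u P.Np = P.target t S i ∧
      P.pred i (S.x i) u P.Np 2 = P.drag i (P.pred i (S.x i) u P.Np 1) := by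
  have hc : ((P.sources i).card : ℝ) ≠ 0 := by
    exact_mod_cast (P.sources_nonempty htree i).card_ne_zero
  unfold InputFeasible err target
  simp only [assumed_sub_gap, Finset.sum_add_distrib, smul_add, Finset.sum_const]
  rw [← Nat.cast_smul_eq_nsmul ℝ, smul_smul, one_div_mul_cancel hc, one_smul, sub_eq_iff_eq_add]

/-- Squared Euclidean length of an output. -/
def nsq (x : Output) : ℝ := x 0 ^ 2 + x 1 ^ 2

lemma nsq_nonneg (x : Output) : 0 ≤ nsq x := by unfold nsq; positivity

lemma dotProduct_self_eq_nsq (x : Output) : x ⬝ᵥ x = nsq x := by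
  simp [dotProduct, Fin.sum_univ_two, nsq, sq]

open Classical in
/-- `1` for a vehicle that receives information from the leader, `0` otherwise. -/
noncomputable def pin (i : Fin N) : ℝ := if P.pinned i then 1 else 0

lemma pin_nonneg (i : Fin N) : 0 ≤ P.pin i := by unfold pin; split_ifs <;> norm_num

lemma pin_le_one (i : Fin N) : P.pin i ≤ 1 := by unfold pin; split_ifs <;> norm_num

/-- The part of the cost other than the deviation from the own assumed output, with unit weights. -/
noncomputable def baseCost (t : ℕ) (S : LoopState N) (i : Fin N) (u : Fin P.Np → ℝ) : ℝ :=
  ∑ k ∈ Finset.range P.Np, (P.pin i * nsq (P.err i t (S.x i) u k) + P.res i (S.x i) u k ^ 2 +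
    ∑ j ∈ P.inNbrs i, nsq (P.err i t (S.x i) u k - P.aerr t S j k))

/-- Cost of deviating from the own assumed output. -/
noncomputable def trackCost (F : Weight) (t : ℕ) (S : LoopState N) (i : Fin N)
    (u : Fin P.Np → ℝ) : ℝ :=
  ∑ k ∈ Finset.range P.Np, wnorm F (P.err i t (S.x i) u k - P.aerr t S i k)

lemma cost_eq (t : ℕ) (S : LoopState N) (i : Fin N) (w : Decision P.Np) :
    P.cost t S i w = ∑ k ∈ Finset.range P.Np,
      (wnorm w.Q (P.err i t (S.x i) w.u k) + w.R * P.res i (S.x i) w.u k ^ 2 +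
        wnorm w.F (P.err i t (S.x i) w.u k - P.aerr t S i k) +
        ∑ j ∈ P.inNbrs i, wnorm w.G (P.err i t (S.x i) w.u k - P.aerr t S j k)) := by
  rw [Finset.sum_range]
  unfold cost
  refine Finset.sum_congr rfl fun k _ => ?_
  simp only [res_of_lt, output_sub_add_gap P i _ t]
  rw [show P.err i t (S.x i) w.u k - P.aerr t S i k = gam *ᵥ P.pred i (S.x i) w.u k - S.ya i k by
    simp [err, aerr]]
  rfl

end

/-! ### Quadratic forms, admissible weights and elimination of the weights. -/

section

variable {N : ℕ} (P : Platoon N)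

lemma wnorm_zero (x : Output) : wnorm 0 x = 0 := by simp [wnorm]

lemma wnorm_vec_zero (A : Weight) : wnorm A 0 = 0 := by simp [wnorm]

lemma wnorm_smul_one (c : ℝ) (x : Output) : wnorm (c • (1 : Weight)) x = c * nsq x := by
  rw [← dotProduct_self_eq_nsq, wnorm, Matrix.smul_mulVec, Matrix.one_mulVec, dotProduct_smul,
    smul_eq_mul]

lemma wnorm_add (A B : Weight) (x : Output) : wnorm (A + B) x = wnorm A x + wnorm B x := by
  rw [wnorm, Matrix.add_mulVec, dotProduct_add]
  rfl

lemma wnorm_eq (A : Weight) (x : Output) :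
    wnorm A x = A 0 0 * x 0 ^ 2 + (A 0 1 + A 1 0) * (x 0 * x 1) + A 1 1 * x 1 ^ 2 := by
  simp [wnorm, Matrix.mulVec, dotProduct, Fin.sum_univ_two]
  ring

lemma wnorm_nonneg_of_posSemidef {A : Weight} (hA : A.PosSemidef) (x : Output) :
    0 ≤ wnorm A x := by
  simpa [wnorm] using hA.dotProduct_mulVec_nonneg x

lemma epsPosDef_smul_one (c : ℝ) : EpsPosDef c (c • (1 : Weight)) :=
  ⟨by simp [Matrix.IsSymm], fun x => by rw [wnorm_smul_one, dotProduct_self_eq_nsq]⟩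

lemma epsPosDef_add {c e : ℝ} {A B : Weight} (hA : EpsPosDef c A) (hB : EpsPosDef e B) :
    EpsPosDef (c + e) (A + B) :=
  ⟨hA.1.add hB.1, fun x => by rw [wnorm_add, add_mul]; exact add_le_add (hA.2 x) (hB.2 x)⟩

lemma epsPosDef_mono {c e : ℝ} {A : Weight} (hA : EpsPosDef c A) (h : e ≤ c) : EpsPosDef e A :=
  ⟨hA.1, fun x => (mul_le_mul_of_nonneg_right h
    (by rw [dotProduct_self_eq_nsq]; exact nsq_nonneg x)).trans (hA.2 x)⟩

lemma epsPosDef_zero_of_posSemidef {A : Weight} (hA : A.PosSemidef) : EpsPosDef 0 A :=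
  ⟨by simpa [Matrix.IsHermitian, Matrix.IsSymm] using hA.1,
    fun x => by rw [zero_mul]; exact wnorm_nonneg_of_posSemidef hA x⟩

lemma epsPosDef_sum {ι : Type*} {s : Finset ι} {c : ℝ} (hc : 0 ≤ c) (hs : s.Nonempty)
    {G : ι → Weight} (hG : ∀ j ∈ s, EpsPosDef c (G j)) : EpsPosDef c (∑ j ∈ s, G j) := by
  classical
  induction hs using Finset.Nonempty.cons_induction with
  | singleton a => simpa using hG
  | cons a s ha hs ih =>
    rw [Finset.sum_cons]
    exact epsPosDef_mono (epsPosDef_add (hG a (by simp)) (ih fun j hj => hG j (by simp [hj])))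
      (by linarith)

/-- The weights `G` of all vehicles obey the bounds imposed on them. -/
def AdmissibleG (G : Fin N → Weight) : Prop :=
  ∀ i, (P.inNbrs i).Nonempty → EpsPosDef P.ε (G i)

lemma inNbrs_nonempty_of_mem_outNbrs {i j : Fin N} (h : j ∈ P.outNbrs i) :
    (P.inNbrs j).Nonempty :=
  ⟨i, by simpa [inNbrs, outNbrs] using h⟩

/-- A receiver of information from `i` has an in-neighbour, namely `i`, so its G is ⪰ ε; F dominates
the sum of these. -/
lemma WeightFeasible.epsPosDef_F {P : Platoon N} {G : Fin N → Weight} (hG : P.AdmissibleG G)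
    {i : Fin N} {w : Decision P.Np} (hw : P.WeightFeasible G i w) : EpsPosDef P.ε w.F := by
  obtain ⟨-, -, -, -, -, -, h7, h8⟩ := hw
  rcases (P.outNbrs i).eq_empty_or_nonempty with h | h
  · exact h7 h
  · have h1 := epsPosDef_sum P.ε_pos.le h
      fun j hj => hG j (P.inNbrs_nonempty_of_mem_outNbrs hj)
    have h2 := epsPosDef_add (epsPosDef_zero_of_posSemidef (h8 h)) h1
    rwa [sub_add_cancel, zero_add] at h2

/-- The cost is monotone in Q, R and G, each of which is bounded below by its minimal value. `F` is
kept because its lower bound depends on other vehicles. -/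
lemma cost_ge {G : Fin N → Weight} {i : Fin N} {w : Decision P.Np}
    (hw : P.WeightFeasible G i w) (t : ℕ) (S : LoopState N) :
    P.ε * P.baseCost t S i w.u + P.trackCost w.F t S i w.u ≤ P.cost t S i w := by
  obtain ⟨h1, h2, h3, h4, h5, -, -, -⟩ := hw
  rw [cost_eq, baseCost, trackCost, Finset.mul_sum, ← Finset.sum_add_distrib]
  refine Finset.sum_le_sum fun k _ => ?_
  have hQ : P.ε * (P.pin i * nsq (P.err i t (S.x i) w.u k)) ≤
      wnorm w.Q (P.err i t (S.x i) w.u k) := by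
    by_cases hp : P.pinned i
    · have := (h1 hp).2 (P.err i t (S.x i) w.u k)
      rw [dotProduct_self_eq_nsq] at this
      simpa [pin, hp, sub_eq_zero.mp h3] using this
    · simp [pin, hp, h2 hp, wnorm_zero]
  have hR := mul_le_mul_of_nonneg_right h4 (sq_nonneg (P.res i (S.x i) w.u k))
  have hN : P.ε * ∑ j ∈ P.inNbrs i, nsq (P.err i t (S.x i) w.u k - P.aerr t S j k) ≤
      ∑ j ∈ P.inNbrs i, wnorm w.G (P.err i t (S.x i) w.u k - P.aerr t S j k) := by
    rw [Finset.mul_sum]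
    refine Finset.sum_le_sum fun j hj => ?_
    have := (h5 ⟨j, hj⟩).2 (P.err i t (S.x i) w.u k - P.aerr t S j k)
    rwa [dotProduct_self_eq_nsq] at this
  linarith

open Classical in
/-- The decision with inputs `u`, weight `F` and all other weights minimal. -/
noncomputable def minimalDecision (i : Fin N) (u : Fin P.Np → ℝ) (F : Weight) :
    Decision P.Np where
  u := u
  Q := if P.pinned i then P.ε • 1 else 0
  Θ := if P.pinned i then P.ε • 1 else 0
  R := P.ε
  F := F
  G := if (P.inNbrs i).Nonempty then P.ε • 1 else 0

lemma cost_minimalDecision (t : ℕ) (S : LoopState N) (i : Fin N) (u : Fin P.Np → ℝ)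
    (F : Weight) :
    P.cost t S i (P.minimalDecision i u F) =
      P.ε * P.baseCost t S i u + P.trackCost F t S i u := by
  rw [cost_eq, baseCost, trackCost, Finset.mul_sum, ← Finset.sum_add_distrib]
  refine Finset.sum_congr rfl fun k _ => ?_
  have hQ : wnorm (P.minimalDecision i u F).Q (P.err i t (S.x i) u k) =
      P.ε * (P.pin i * nsq (P.err i t (S.x i) u k)) := by
    by_cases hp : P.pinned i <;> simp [minimalDecision, pin, hp, wnorm_smul_one, wnorm_zero]
  have hN : ∑ j ∈ P.inNbrs i,
      wnorm (P.minimalDecision i u F).G (P.err i t (S.x i) u k - P.aerr t S j k) =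
      P.ε * ∑ j ∈ P.inNbrs i, nsq (P.err i t (S.x i) u k - P.aerr t S j k) := by
    rw [Finset.mul_sum]
    refine Finset.sum_congr rfl fun j hj => ?_
    have : (P.inNbrs i).Nonempty := ⟨j, hj⟩
    simp [minimalDecision, this, wnorm_smul_one]
  rw [show (P.minimalDecision i u F).u = u from rfl, hQ, hN]
  simp only [minimalDecision]
  ring

lemma weightFeasible_minimalDecision {G : Fin N → Weight} {i : Fin N} {F : Weight}
    (h1 : P.outNbrs i = ∅ → EpsPosDef P.ε F)
    (h2 : (P.outNbrs i).Nonempty → (F - ∑ j ∈ P.outNbrs i, G j).PosSemidef)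
    (u : Fin P.Np → ℝ) : P.WeightFeasible G i (P.minimalDecision i u F) := by
  refine ⟨fun hp => ?_, fun hp => ?_, ?_, le_rfl, fun h => ?_, fun h => ?_, h1, h2⟩
  · simpa [minimalDecision, hp] using epsPosDef_smul_one P.ε
  · simp [minimalDecision, hp]
  · simp [minimalDecision]
  · simpa [minimalDecision, h] using epsPosDef_smul_one P.ε
  · simp [minimalDecision, h]

lemma IsSolution.admissibleG {P : Platoon N} {t : ℕ} {S : LoopState N}
    {W : Fin N → Decision P.Np} (hW : P.IsSolution t S W) :
    P.AdmissibleG fun j => (W j).G :=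
  fun i hi => (hW i).1.2.2.2.2.2.1 hi

lemma IsSolution.epsPosDef_F {P : Platoon N} {t : ℕ} {S : LoopState N}
    {W : Fin N → Decision P.Np} (hW : P.IsSolution t S W) (i : Fin N) :
    EpsPosDef P.ε (W i).F :=
  (hW i).1.2.epsPosDef_F hW.admissibleG

/-- Optimality of the inputs for the weight `F` of the solution and minimal other weights. -/
lemma IsSolution.le {P : Platoon N} {t : ℕ} {S : LoopState N}
    {W : Fin N → Decision P.Np} (hW : P.IsSolution t S W) (i : Fin N)
    {u : Fin P.Np → ℝ} (hu : P.InputFeasible t S i u) :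
    P.ε * P.baseCost t S i (W i).u + P.trackCost (W i).F t S i (W i).u ≤
      P.ε * P.baseCost t S i u + P.trackCost (W i).F t S i u := by
  obtain ⟨-, -, -, -, -, -, h7, h8⟩ := (hW i).1.2
  -- Competitor: the inputs `u` with the solution's own `F`, whose constraint stays satisfied, and
  -- all other weights minimal.
  refine (P.cost_ge (hW i).1.2 t S).trans ?_
  rw [← cost_minimalDecision]
  exact (hW i).2 _ ⟨hu, P.weightFeasible_minimalDecision h7 h8 u⟩

/-! ### Existence of joint solutions -/

lemma continuous_pred (i : Fin N) (x : State) (k : ℕ) : Continuous fun u => P.pred i x u k := by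
  have hd := P.continuous_drag i
  induction k with
  | zero => exact continuous_const
  | succ k ih =>
    have hc : ∀ l, Continuous fun u => P.pred i x u k l := fun l => (continuous_apply l).comp ih
    have h0 := hc 0
    have h1 := hc 1
    have h2 := hc 2
    have hr : Continuous fun u => P.res i x u k := by
      unfold res
      by_cases hk : k < P.Np
      · simp only [hk, dif_pos]
        exact (continuous_apply _).sub (hd.comp h1)
      · simp only [hk, dif_neg, not_false_iff]
        exact (hd.comp h1).sub (hd.comp h1)
    have hd1 := hd.comp h1
    refine continuous_pi fun l => ?_
    fin_cases l
    · simp only [Fin.zero_eta, pred_succ_zero]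
      fun_prop
    · simp only [Fin.mk_one, pred_succ_one]
      exact h1.add (continuous_const.mul (h2.sub hd1))
    · simp only [Fin.reduceFinMk, pred_succ_two]
      exact h2.add (continuous_const.mul ((hr.add hd1).sub h2))

lemma continuous_res (i : Fin N) (x : State) (k : ℕ) : Continuous fun u => P.res i x u k := by
  have h1 := (P.continuous_drag i).comp ((continuous_apply 1).comp (P.continuous_pred i x k))
  unfold res
  by_cases hk : k < P.Np
  · simp only [hk, dif_pos]
    exact (continuous_apply _).sub h1
  · simp only [hk, dif_neg, not_false_iff]
    exact h1.sub h1

lemma continuous_err (i : Fin N) (t : ℕ) (x : State) (k : ℕ) :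
    Continuous fun u => P.err i t x u k := by
  unfold err
  exact (Continuous.matrix_mulVec continuous_const (P.continuous_pred i x k)).sub continuous_const

lemma continuous_nsq : Continuous nsq := by
  unfold nsq
  fun_prop

lemma continuous_wnorm (A : Weight) : Continuous (wnorm A) := by
  unfold wnorm
  fun_prop

lemma continuous_baseCost (t : ℕ) (S : LoopState N) (i : Fin N) :
    Continuous (P.baseCost t S i) := by
  unfold baseCost
  have h1 := fun k => P.continuous_err i t (S.x i) k
  have h2 := fun k => P.continuous_res i (S.x i) k
  refine continuous_finsetSum _ fun k _ => ?_
  refine ((continuous_const.mul (continuous_nsq.comp (h1 k))).add ((h2 k).pow 2)).add ?_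
  exact continuous_finsetSum _ fun j _ => continuous_nsq.comp ((h1 k).sub continuous_const)

lemma continuous_trackCost (F : Weight) (t : ℕ) (S : LoopState N) (i : Fin N) :
    Continuous (P.trackCost F t S i) := by
  unfold trackCost
  exact continuous_finsetSum _ fun k _ =>
    (continuous_wnorm F).comp ((P.continuous_err i t (S.x i) k).sub continuous_const)

lemma isCompact_inputFeasible (t : ℕ) (S : LoopState N) (i : Fin N) :
    IsCompact {u | P.InputFeasible t S i u} := by
  have hp := P.continuous_pred i (S.x i) P.Np
  have hbox : IsCompact {u : Fin P.Np → ℝ | ∀ k, u k ∈ Set.Icc (P.veh i).umin (P.veh i).umax} := by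
    have := isCompact_univ_pi fun _ : Fin P.Np =>
      isCompact_Icc (a := (P.veh i).umin) (b := (P.veh i).umax)
    simpa [Set.pi] using this
  exact hbox.inter_right
    ((isClosed_eq (Continuous.matrix_mulVec continuous_const hp) continuous_const).inter
      (isClosed_eq ((continuous_apply 2).comp hp)
        ((P.continuous_drag i).comp ((continuous_apply 1).comp hp))))

/-- Feasibility of the input constraints suffices for the existence of a joint solution. -/
lemma exists_isSolution (t : ℕ) (S : LoopState N) (h : ∀ i, ∃ u, P.InputFeasible t S i u) :
    ∃ W, P.IsSolution t S W := by
  classical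
  -- Fixing all `G` at their minimum, independently of the inputs, decouples the problems; `F` is
  -- then the least matrix allowed, and only a minimization of a continuous function over a compact
  -- set of inputs remains.
  let G : Fin N → Weight := fun i => if (P.inNbrs i).Nonempty then P.ε • 1 else 0
  let F : Fin N → Weight := fun i =>
    if (P.outNbrs i).Nonempty then ∑ j ∈ P.outNbrs i, G j else P.ε • 1
  have hmin : ∀ i, ∃ u, P.InputFeasible t S i u ∧ ∀ u', P.InputFeasible t S i u' →
      P.ε * P.baseCost t S i u + P.trackCost (F i) t S i u ≤
        P.ε * P.baseCost t S i u' + P.trackCost (F i) t S i u' := by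
    intro i
    obtain ⟨u, hu, hle⟩ := (P.isCompact_inputFeasible t S i).exists_isMinOn (h i)
      ((continuous_const.mul (P.continuous_baseCost t S i)).add
        (P.continuous_trackCost (F i) t S i)).continuousOn
    exact ⟨u, hu, fun u' hu' => hle hu'⟩
  choose u hu hle using hmin
  refine ⟨fun i => P.minimalDecision i (u i) (F i), fun i => ?_⟩
  have hG : (fun j => (P.minimalDecision j (u j) (F j)).G) = G := by
    funext j
    simp [minimalDecision, G]
  rw [hG]
  refine ⟨⟨hu i, P.weightFeasible_minimalDecision (fun h => ?_) (fun h => ?_) _⟩,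
    fun w hw => ?_⟩
  · simpa [F, h] using epsPosDef_smul_one P.ε
  · simpa [F, h] using Matrix.PosSemidef.zero
  · rw [cost_minimalDecision]
    refine (hle i w.u hw.1).trans (le_trans ?_ (P.cost_ge hw.2 t S))
    refine add_le_add le_rfl (Finset.sum_le_sum fun k _ => ?_)
    obtain ⟨-, -, -, -, -, -, h7, h8⟩ := hw.2
    rcases (P.outNbrs i).eq_empty_or_nonempty with ho | ho
    · have := (h7 ho).2 (P.err i t (S.x i) w.u k - P.aerr t S i k)
      rw [dotProduct_self_eq_nsq] at this
      simpa [F, ho, wnorm_smul_one] using this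
    · have := wnorm_nonneg_of_posSemidef (h8 ho) (P.err i t (S.x i) w.u k - P.aerr t S i k)
      have h2 := wnorm_add (w.F - ∑ j ∈ P.outNbrs i, G j) (∑ j ∈ P.outNbrs i, G j)
        (P.err i t (S.x i) w.u k - P.aerr t S i k)
      rw [sub_add_cancel] at h2
      simp only [F, ho, if_true]
      linarith

end

section

variable {N : ℕ} (P : Platoon N)

/-! ### Controllability: predictions are parametrized by their velocities -/

/-- Torque needed for the velocity errors `ω`. -/
noncomputable def flatTorque (i : Fin N) (ω : ℕ → ℝ) (k : ℕ) : ℝ :=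
  P.drag i (P.v0 + ω k) + (ω (k + 1) - ω k) / P.gain i

/-- Input needed for the velocity errors `ω`. -/
noncomputable def flatInput (i : Fin N) (ω : ℕ → ℝ) (k : ℕ) : ℝ :=
  P.flatTorque i ω k +
    (P.veh i).τ / P.dt * (P.flatTorque i ω (k + 1) - P.flatTorque i ω k)

lemma pred_flatInput (i : Fin N) (t : ℕ) (x : State) (ω : ℕ → ℝ)
    (h1 : x 1 = P.v0 + ω 0) (h2 : x 2 = P.flatTorque i ω 0) {k : ℕ} (hk : k ≤ P.Np) :
    P.pred i x (fun k => P.flatInput i ω k) k 0 =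
        P.des i (t + k) 0 + (x 0 - P.des i t 0 + P.dt * ∑ j ∈ Finset.range k, ω j) ∧
      P.pred i x (fun k => P.flatInput i ω k) k 1 = P.v0 + ω k ∧
      P.pred i x (fun k => P.flatInput i ω k) k 2 = P.flatTorque i ω k := by
  have hg := (P.gain_pos i).ne'
  have hτ := (P.veh i).τ_pos.ne'
  have hd := P.dt_pos.ne'
  induction k with
  | zero => simp [pred_zero, h1, h2]
  | succ k ih =>
    obtain ⟨i0, i1, i2⟩ := ih (by omega)
    refine ⟨?_, ?_, ?_⟩
    · rw [pred_succ_zero, i0, i1, ← add_assoc t, des_succ_zero, Finset.sum_range_succ]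
      ring
    · rw [pred_succ_one, i1, i2, flatTorque]
      field_simp
      ring
    · have := P.res_of_lt i x (fun k => P.flatInput i ω k) ⟨k, hk⟩
      simp only at this
      rw [pred_succ_two, i2, this, flatInput]
      field_simp
      ring

/-- Velocity errors of a motion from the state error `z.1` to the terminal output error `z.2`. -/
noncomputable def steer (i : Fin N) (z : State × Output) : ℕ → ℝ
  | 0 => z.1 1
  | 1 => z.1 1 + P.gain i * (z.1 2 + P.drag i P.v0 - P.drag i (P.v0 + z.1 1))
  | 2 => (z.2 0 - z.1 0) / P.dt - z.1 1 -
      (z.1 1 + P.gain i * (z.1 2 + P.drag i P.v0 - P.drag i (P.v0 + z.1 1))) -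
      ((P.Np : ℝ) - 3) * z.2 1
  | _ + 3 => z.2 1

lemma steer_zero (i : Fin N) (k : ℕ) : P.steer i 0 k = 0 := by
  rcases k with _ | _ | _ | k <;> simp [steer]

lemma continuous_steer (i : Fin N) (k : ℕ) : Continuous fun z => P.steer i z k := by
  have hd : Continuous fun z : State × Output => P.drag i (P.v0 + z.1 1) :=
    (P.continuous_drag i).comp (by fun_prop)
  rcases k with _ | _ | _ | k <;> simp only [steer] <;> fun_prop

/-- The velocity errors at indices 0 and 1 are forced by the initial velocity and torque, and those
from index 3 on equal the terminal one. The single free value, at index 2, is solved from this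
position balance. -/
lemma sum_steer (hNp : 3 ≤ P.Np) (i : Fin N) (z : State × Output) :
    z.1 0 + P.dt * ∑ j ∈ Finset.range P.Np, P.steer i z j = z.2 0 := by
  obtain ⟨n, hn⟩ := Nat.exists_eq_add_of_le' hNp
  have hd := P.dt_pos.ne'
  rw [hn, Finset.sum_range_succ', Finset.sum_range_succ', Finset.sum_range_succ']
  simp only [steer, Finset.sum_const, Finset.card_range, hn]
  push_cast
  rw [nsmul_eq_mul]
  field_simp
  ring

open Filter Topology in
/-- From a state near the desired one, every terminal output near the desired one is reached by
a motion near the desired motion. -/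
lemma exists_steering (hNp : 3 ≤ P.Np)
    (hu : ∀ i, (P.veh i).umin < P.drag i P.v0 ∧ P.drag i P.v0 < (P.veh i).umax)
    (i : Fin N) {η : ℝ} (hη : 0 < η) :
    ∃ δ > 0, ∀ (t : ℕ) (x : State) (y : Output),
      (∀ l, |x l - P.des i t l| ≤ δ) → (∀ l, |y l| ≤ δ) →
      ∃ u : Fin P.Np → ℝ, (∀ k, u k ∈ Set.Icc (P.veh i).umin (P.veh i).umax) ∧
        P.err i t x u P.Np = y ∧
        P.pred i x u P.Np 2 = P.drag i (P.pred i x u P.Np 1) ∧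
        (∀ k ≤ P.Np, ∀ l, |P.err i t x u k l| ≤ η) ∧ ∀ k, |P.res i x u k| ≤ η := by
  have hω := P.continuous_steer i
  have hdω : ∀ k, Continuous fun z => P.drag i (P.v0 + P.steer i z k) := fun k =>
    (P.continuous_drag i).comp (continuous_const.add (hω k))
  have hT : ∀ k, Continuous fun z => P.flatTorque i (P.steer i z) k := fun k =>
    (hdω k).add (((hω (k + 1)).sub (hω k)).div_const _)
  have hU : ∀ k, Continuous fun z => P.flatInput i (P.steer i z) k := fun k =>
    (hT k).add (continuous_const.mul ((hT (k + 1)).sub (hT k)))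
  have hU0 : ∀ k, P.flatInput i (P.steer i 0) k = P.drag i P.v0 := by
    intro k
    simp [flatInput, flatTorque, steer_zero]
  -- All requirements involve only the error `z` and hold with room at `z = 0`; hence the radius
  -- will not depend on `t`.
  have hev : ∀ k ≤ P.Np, ∀ᶠ z in 𝓝 (0 : State × Output),
      P.flatInput i (P.steer i z) k ∈ Set.Icc (P.veh i).umin (P.veh i).umax ∧
      |P.flatInput i (P.steer i z) k - P.drag i (P.v0 + P.steer i z k)| ≤ η ∧
      |P.steer i z k| ≤ η ∧
      |z.1 0 + P.dt * ∑ j ∈ Finset.range k, P.steer i z j| ≤ η := by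
    intro k _
    have small : ∀ f : State × Output → ℝ, Continuous f → f 0 = 0 →
        ∀ᶠ z in 𝓝 (0 : State × Output), |f z| ≤ η := by
      intro f hf h0
      exact hf.abs.continuousAt.eventually_le_const (by simpa [h0])
    refine ((hU k).continuousAt.eventually_mem (Icc_mem_nhds ?_ ?_)).and ((small _ ((hU k).sub (hdω k)) ?_).and
      ((small _ (hω k) (P.steer_zero i k)).and (small _ ?_ ?_)))
    · rw [hU0]; exact (hu i).1
    · rw [hU0]; exact (hu i).2
    · simp [hU0, steer_zero]
    · exact Continuous.add (by fun_prop)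
        (continuous_const.mul (continuous_finsetSum _ fun j _ => hω j))
    · simp [steer_zero]
  have hall := (Filter.eventually_all_finite (Set.finite_Iic P.Np)).2 hev
  obtain ⟨δ, hδ, hball⟩ := Metric.nhds_basis_closedBall.eventually_iff.1 hall
  refine ⟨δ, hδ, fun t x y hx hy => ?_⟩
  set z : State × Output := (x - P.des i t, y) with hz
  have hzmem : z ∈ Metric.closedBall (0 : State × Output) δ := by
    rw [mem_closedBall_zero_iff, norm_prod_le_iff, pi_norm_le_iff_of_nonneg hδ.le,
      pi_norm_le_iff_of_nonneg hδ.le]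
    exact ⟨hx, hy⟩
  have hP := hball hzmem
  have h1 : x 1 = P.v0 + P.steer i z 0 := by simp [steer, hz, des_one]
  have h2 : x 2 = P.flatTorque i (P.steer i z) 0 := by
    have := (P.gain_pos i).ne'
    simp [flatTorque, steer, hz, des_one, des_two, this]
  have key := fun k (hk : k ≤ P.Np) => P.pred_flatInput i t x (P.steer i z) h1 h2 hk
  -- Two equal consecutive velocities at the end make the terminal torque equal to the drag; three
  -- steps of horizon are what puts both indices in the constant tail.
  have hlast : P.steer i z P.Np = y 1 ∧ P.steer i z (P.Np + 1) = y 1 := by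
    obtain ⟨n, hn⟩ := Nat.exists_eq_add_of_le' hNp
    rw [hn]
    exact ⟨rfl, rfl⟩
  refine ⟨fun k => P.flatInput i (P.steer i z) k, fun k => (hP k k.2.le).1, ?_, ?_, ?_, ?_⟩
  · ext l
    fin_cases l
    · simp only [Fin.zero_eta, err_zero, (key _ le_rfl).1]
      rw [add_sub_cancel_left]
      exact P.sum_steer hNp i z
    · simp only [Fin.mk_one, err_one, (key _ le_rfl).2.1]
      rw [add_sub_cancel_left, hlast.1]
  · rw [(key _ le_rfl).2.2, (key _ le_rfl).2.1, flatTorque, hlast.1, hlast.2]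
    simp
  · intro k hk l
    fin_cases l
    · simp only [Fin.zero_eta, err_zero, (key _ hk).1]
      rw [add_sub_cancel_left]
      exact (hP k hk).2.2.2
    · simp only [Fin.mk_one, err_one, (key _ hk).2.1]
      rw [add_sub_cancel_left]
      exact (hP k hk).2.2.1
  · intro k
    rcases lt_or_ge k P.Np with hk | hk
    · have := P.res_of_lt i x (fun k => P.flatInput i (P.steer i z) k) ⟨k, hk⟩
      simp only at this
      rw [this, (key _ hk.le).2.1]
      exact (hP k hk.le).2.1
    · rw [res_of_le _ _ _ _ hk, abs_zero]
      exact hη.le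

/-! ### Recovering positions from a degenerate quadratic form of the outputs -/

/-- A discrete Grönwall estimate: the bound at step `k` already exceeds `m`, so each step costs at
most a factor `2 * c`. -/
lemma abs_le_of_forward {n : ℕ} {σ : ℕ → ℝ} {c m : ℝ} (hc : 1 ≤ c) (hm : 0 ≤ m)
    (h0 : |σ 0| ≤ m) (h : ∀ k < n, |σ (k + 1)| ≤ c * (|σ k| + m)) :
    ∀ k ≤ n, |σ k| ≤ (2 * c) ^ n * m := by
  have h' : ∀ k ≤ n, |σ k| ≤ (2 * c) ^ k * m := by
    intro k hk
    induction k with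
    | zero => simpa using h0
    | succ k ih =>
      have hp : m ≤ (2 * c) ^ k * m := le_mul_of_one_le_left hm (one_le_pow₀ (by linarith))
      calc |σ (k + 1)| ≤ c * (|σ k| + m) := h k hk
        _ ≤ c * ((2 * c) ^ k * m + (2 * c) ^ k * m) := by gcongr; exact ih (by omega)
        _ = (2 * c) ^ (k + 1) * m := by ring
  intro k hk
  refine (h' k hk).trans ?_
  gcongr
  linarith

lemma abs_le_of_backward {n : ℕ} {σ : ℕ → ℝ} {c m : ℝ} (hc : 1 ≤ c) (hm : 0 ≤ m)
    (hn : |σ n| ≤ m) (h : ∀ k < n, |σ k| ≤ c * (|σ (k + 1)| + m)) :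
    ∀ k ≤ n, |σ k| ≤ (2 * c) ^ n * m := by
  intro k hk
  have := abs_le_of_forward (n := n) (σ := fun j => σ (n - j)) hc hm (by simpa using hn)
    (fun j hj => by
      have := h (n - (j + 1)) (by omega)
      rwa [show n - (j + 1) + 1 = n - j by omega] at this) (n - k) (by omega)
  simpa [Nat.sub_sub_self hk] using this

/-- The values of the form at `x` and at `x` rotated by a right angle add up to the right-hand side,
and the second is nonnegative. -/
lemma wnorm_le_trace_mul {c : ℝ} (hc : 0 ≤ c) {F : Weight} (hF : EpsPosDef c F) (x : Output) :
    wnorm F x ≤ (F 0 0 + F 1 1) * nsq x := by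
  have h := hF.2 ![x 1, -x 0]
  rw [dotProduct_self_eq_nsq] at h
  have h2 := (mul_nonneg hc (nsq_nonneg _)).trans h
  rw [wnorm_eq] at h2 ⊢
  simp only [Matrix.cons_val_zero, Matrix.cons_val_one, nsq] at h2 ⊢
  nlinarith

/-- Parallelogram identity with the term for `x - y` dropped. -/
lemma wnorm_add_le {c : ℝ} (hc : 0 ≤ c) {F : Weight} (hF : EpsPosDef c F) (x y : Output) :
    wnorm F (x + y) ≤ 2 * wnorm F x + 2 * wnorm F y := by
  have h := hF.2 (x - y)
  rw [dotProduct_self_eq_nsq] at h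
  have h2 := (mul_nonneg hc (nsq_nonneg _)).trans h
  rw [wnorm_eq] at h2 ⊢
  rw [wnorm_eq, wnorm_eq]
  simp only [Pi.sub_apply, Pi.add_apply] at h2 ⊢
  nlinarith

/-- A positive semidefinite form bounds a combination of the coordinates whose larger coefficient
is `1`, at the scale of the trace. -/
lemma abs_combination_le {F : Weight} (hF : EpsPosDef 0 F) (hμ : 0 < F 0 0 + F 1 1) {m : ℝ}
    (hm : 0 ≤ m) :
    ∃ β : ℝ, |β| ≤ 1 ∧
      ((∀ x : Output, wnorm F x ≤ m ^ 2 * (F 0 0 + F 1 1) → |x 0 + β * x 1| ≤ 2 * m) ∨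
        ∀ x : Output, wnorm F x ≤ m ^ 2 * (F 0 0 + F 1 1) → |x 1 + β * x 0| ≤ 2 * m) := by
  have hs : F 1 0 = F 0 1 := hF.1.apply 0 1
  have hpos : ∀ x, 0 ≤ wnorm F x := fun x => by simpa using hF.2 x
  -- At these two vectors the form equals the determinant times a diagonal entry, which gives a
  -- nonnegative determinant.
  have h1 := hpos ![F 0 1, -F 0 0]
  have h2 := hpos ![-F 1 1, F 0 1]
  simp only [wnorm_eq, hs] at h1 h2 ⊢
  simp only [Matrix.cons_val_zero, Matrix.cons_val_one] at h1 h2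
  generalize F 0 0 = a at *
  generalize F 0 1 = b at *
  generalize F 1 1 = c at *
  rcases le_total c a with hac | hac
  · have ha : 0 < a := by linarith
    have hdet : 0 ≤ a * c - b ^ 2 := by
      by_contra hneg
      nlinarith
    refine ⟨b / a, ?_, Or.inl fun x hx => ?_⟩
    · rw [abs_div, div_le_one (abs_pos.2 ha.ne')]
      exact sq_le_sq.1 (by nlinarith)
    · have e : x 0 + b / a * x 1 = (a * x 0 + b * x 1) / a := by field_simp
      rw [e, abs_div, abs_of_pos ha, div_le_iff₀ ha]
      -- Completing the square: a times the form is (a x₀ + b x₁)² plus the determinant times x₁²,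
      -- and the trace is at most 2a.
      refine abs_le_of_sq_le_sq ?_ (by positivity)
      have := mul_le_mul_of_nonneg_left hx ha.le
      nlinarith [mul_nonneg hdet (sq_nonneg (x 1)), mul_nonneg (sq_nonneg m)
        (mul_nonneg ha.le (sub_nonneg.2 hac)), mul_nonneg (sq_nonneg m) (sq_nonneg a)]
  · have hc : 0 < c := by linarith
    have hdet : 0 ≤ a * c - b ^ 2 := by
      by_contra hneg
      nlinarith
    refine ⟨b / c, ?_, Or.inr fun x hx => ?_⟩
    · rw [abs_div, div_le_one (abs_pos.2 hc.ne')]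
      exact sq_le_sq.1 (by nlinarith)
    · have e : x 1 + b / c * x 0 = (c * x 1 + b * x 0) / c := by field_simp
      rw [e, abs_div, abs_of_pos hc, div_le_iff₀ hc]
      refine abs_le_of_sq_le_sq ?_ (by positivity)
      have := mul_le_mul_of_nonneg_left hx hc.le
      nlinarith [mul_nonneg hdet (sq_nonneg (x 0)), mul_nonneg (sq_nonneg m)
        (mul_nonneg hc.le (sub_nonneg.2 hac)), mul_nonneg (sq_nonneg m) (sq_nonneg c)]

/-- Positions along a motion with small end positions are small if a positive semidefinite form
of the outputs is small compared with its trace. -/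
lemma abs_position_le {h : ℝ} (hh : 0 < h) {F : Weight} (hF : EpsPosDef 0 F)
    (hμ : 0 < F 0 0 + F 1 1) {n : ℕ} {e : ℕ → Output}
    (he : ∀ k < n, e (k + 1) 0 = e k 0 + h * e k 1) {m : ℝ} (hm : 0 ≤ m)
    (h0 : |e 0 0| ≤ m) (hn : |e n 0| ≤ m)
    (hw : ∀ k < n, wnorm F (e k) ≤ m ^ 2 * (F 0 0 + F 1 1)) :
    ∀ k ≤ n, |e k 0| ≤ (2 * (4 + 2 * h)) ^ n * m := by
  obtain ⟨β, hβ, H⟩ := abs_combination_le hF hμ hm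
  have hc : 1 ≤ 4 + 2 * h := by linarith
  rcases H with H | H
  · rcases le_total (h / 2) |β| with hb | hb
    · refine abs_le_of_forward (σ := fun k => e k 0) hc hm h0 fun k hk => ?_
      have hH := H _ (hw k hk)
      have h3 : β * e (k + 1) 0 = h * (e k 0 + β * e k 1) + (β - h) * e k 0 := by
        rw [he k hk]; ring
      have hβpos : 0 < |β| := by linarith
      have h4 : |β| * |e (k + 1) 0| ≤ h * (2 * m) + (|β| + h) * |e k 0| := by
        rw [← abs_mul, h3]
        refine (abs_add_le _ _).trans ?_
        rw [abs_mul, abs_mul, abs_of_pos hh]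
        gcongr
        refine (abs_sub _ _).trans ?_
        rw [abs_of_pos hh]
      refine le_of_mul_le_mul_left (h4.trans ?_) hβpos
      have : 0 ≤ |e k 0| := abs_nonneg _
      nlinarith [mul_nonneg (sub_nonneg.2 hb) hm, mul_nonneg (sub_nonneg.2 hb) this,
        mul_nonneg hβpos.le hm, mul_nonneg hβpos.le this, mul_nonneg hβpos.le (mul_nonneg hh.le hm),
        mul_nonneg hβpos.le (mul_nonneg hh.le this)]
    · refine abs_le_of_backward (σ := fun k => e k 0) hc hm hn fun k hk => ?_
      have hH := H _ (hw k hk)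
      have h3 : (h - β) * e k 0 = h * (e k 0 + β * e k 1) - β * e (k + 1) 0 := by
        rw [he k hk]; ring
      have hpos : h / 2 ≤ h - β := by linarith [le_abs_self β]
      have h4 : (h - β) * |e k 0| ≤ h * (2 * m) + |β| * |e (k + 1) 0| := by
        rw [← abs_of_nonneg (by linarith : 0 ≤ h - β), ← abs_mul, h3]
        refine (abs_sub _ _).trans ?_
        rw [abs_mul, abs_mul, abs_of_pos hh]
        gcongr
      have a1 : 0 ≤ |e k 0| := abs_nonneg _
      have a2 : 0 ≤ |e (k + 1) 0| := abs_nonneg _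
      have h5 : h / 2 * |e k 0| ≤ h / 2 * (4 * m + |e (k + 1) 0|) := by
        nlinarith [mul_nonneg (sub_nonneg.2 hpos) a1, mul_nonneg (sub_nonneg.2 hb) a2]
      have h6 := le_of_mul_le_mul_left h5 (by linarith)
      nlinarith [mul_nonneg hh.le a2, mul_nonneg hh.le hm]
  · refine abs_le_of_forward (σ := fun k => e k 0) hc hm h0 fun k hk => ?_
    have hH := H _ (hw k hk)
    have h3 : e (k + 1) 0 = e k 0 + h * ((e k 1 + β * e k 0) - β * e k 0) := by
      rw [he k hk]; ring
    have a1 : 0 ≤ |e k 0| := abs_nonneg _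
    have h4 : |e (k + 1) 0| ≤ |e k 0| + h * (2 * m + 1 * |e k 0|) := by
      rw [h3]
      refine (abs_add_le _ _).trans ?_
      rw [abs_mul, abs_of_pos hh]
      gcongr
      refine (abs_sub _ _).trans ?_
      rw [abs_mul β]
      gcongr
    nlinarith [mul_nonneg hh.le a1]

end

section

variable {N : ℕ} (P : Platoon N)

/-! ### Dependence of the plans on the closed-loop state -/

lemma exists_pos_forall {ι : Type*} [Finite ι] {p : ι → ℝ → Prop}
    (hp : ∀ i a b, b ≤ a → p i a → p i b) (h : ∀ i, ∃ a > 0, p i a) : ∃ a > 0, ∀ i, p i a := by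
  choose f hf hpf using h
  obtain ⟨M, hM⟩ := Finite.exists_le fun i => (f i)⁻¹
  -- The maximum with 1 keeps the witness positive even when `ι` is empty.
  refine ⟨(max M 1)⁻¹, by positivity, fun i => hp i _ _ ?_ (hpf i)⟩
  exact inv_le_of_inv_le₀ (hf i) ((hM i).trans (le_max_left _ _))

lemma near_iff {e : ℝ} (he : 0 < e) (t : ℕ) (S : LoopState N) :
    P.Near e t S ↔ ∀ i, (∀ l, |S.x i l - P.des i t l| < e) ∧
      ∀ k ≤ P.Np, ∀ l, |P.aerr t S i k l| < e := by
  simp only [Near, pi_norm_lt_iff he, Pi.sub_apply, Real.norm_eq_abs, aerr]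

lemma Near.mono {P : Platoon N} {e e' : ℝ} {t : ℕ} {S : LoopState N} (h : P.Near e t S)
    (he : e ≤ e') : P.Near e' t S :=
  fun i => ⟨(h i).1.trans_le he, fun k hk => ((h i).2 k hk).trans_le he⟩

lemma abs_target_le (htree : P.HasSpanningTree) {t : ℕ} {S : LoopState N} {e : ℝ} (he : 0 ≤ e)
    (h : ∀ i l, |P.aerr t S i P.Np l| ≤ e) (i : Fin N) (l : Fin 2) :
    |P.target t S i l| ≤ e := by
  have hc : (0 : ℝ) < (P.sources i).card := by
    exact_mod_cast (P.sources_nonempty htree i).card_pos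
  have hs : |(∑ a ∈ P.sources i, P.srcErr t S a P.Np) l| ≤ (P.sources i).card * e := by
    rw [Finset.sum_apply, ← nsmul_eq_mul]
    refine (Finset.abs_sum_le_sum_abs _ _).trans (Finset.sum_le_card_nsmul _ _ _ fun a _ => ?_)
    cases a with
    | none => simpa [srcErr] using he
    | some j => exact h j l
  rw [target, Pi.smul_apply, smul_eq_mul, abs_mul, abs_of_pos (by positivity)]
  calc _ ≤ 1 / ((P.sources i).card : ℝ) * ((P.sources i).card * e) := by gcongr
    _ = e := by field_simp

lemma nsq_le {x : Output} {e : ℝ} (h : ∀ l, |x l| ≤ e) : nsq x ≤ 2 * e ^ 2 := by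
  have h0 := sq_le_sq' (neg_le_of_abs_le (h 0)) (le_of_abs_le (h 0))
  have h1 := sq_le_sq' (neg_le_of_abs_le (h 1)) (le_of_abs_le (h 1))
  unfold nsq
  linarith

lemma nsq_sub_le_of_abs_le {x y : Output} {e : ℝ} (hx : ∀ l, |x l| ≤ e) (hy : ∀ l, |y l| ≤ e) :
    nsq (x - y) ≤ 8 * e ^ 2 := by
  have := nsq_le (x := x - y) (e := 2 * e) fun l => (abs_sub _ _).trans
    (by linarith [hx l, hy l])
  linarith

lemma sum_range_le {n : ℕ} {f : ℕ → ℝ} {c : ℝ} (h : ∀ k < n, f k ≤ c) :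
    ∑ k ∈ Finset.range n, f k ≤ n * c := by
  simpa using Finset.sum_le_card_nsmul (Finset.range n) f c fun k hk => h k (Finset.mem_range.1 hk)

lemma baseCost_le {t : ℕ} {S : LoopState N} {i : Fin N} {u : Fin P.Np → ℝ} {e : ℝ}
    (h1 : ∀ k ≤ P.Np, ∀ l, |P.err i t (S.x i) u k l| ≤ e)
    (h2 : ∀ k, |P.res i (S.x i) u k| ≤ e)
    (h3 : ∀ j, ∀ k ≤ P.Np, ∀ l, |P.aerr t S j k l| ≤ e) :
    P.baseCost t S i u ≤ P.Np * ((3 + 8 * N) * e ^ 2) := by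
  refine sum_range_le fun k hk => ?_
  have hk := hk.le
  have a1 : P.pin i * nsq (P.err i t (S.x i) u k) ≤ 1 * (2 * e ^ 2) :=
    mul_le_mul (P.pin_le_one i) (nsq_le (h1 k hk)) (nsq_nonneg _) zero_le_one
  have a2 := sq_le_sq' (neg_le_of_abs_le (h2 k)) (le_of_abs_le (h2 k))
  have a3 : ∑ j ∈ P.inNbrs i, nsq (P.err i t (S.x i) u k - P.aerr t S j k) ≤
      N * (8 * e ^ 2) := by
    refine (Finset.sum_le_univ_sum_of_nonneg fun j => nsq_nonneg _).trans ?_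
    refine (Finset.sum_le_card_nsmul _ _ _ fun j _ =>
      nsq_sub_le_of_abs_le (h1 k hk) (h3 j k hk)).trans ?_
    simp
  nlinarith

lemma baseCost_nonneg (t : ℕ) (S : LoopState N) (i : Fin N) (u : Fin P.Np → ℝ) :
    0 ≤ P.baseCost t S i u :=
  Finset.sum_nonneg fun _ _ => add_nonneg (add_nonneg
    (mul_nonneg (P.pin_nonneg i) (nsq_nonneg _)) (sq_nonneg _))
    (Finset.sum_nonneg fun _ _ => nsq_nonneg _)

lemma wnorm_nonneg {c : ℝ} (hc : 0 ≤ c) {F : Weight} (hF : EpsPosDef c F) (x : Output) :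
    0 ≤ wnorm F x :=
  (mul_nonneg hc (by rw [dotProduct_self_eq_nsq]; exact nsq_nonneg x)).trans (hF.2 x)

lemma two_mul_le_trace {c : ℝ} {F : Weight} (hF : EpsPosDef c F) : 2 * c ≤ F 0 0 + F 1 1 := by
  have h0 := hF.2 ![1, 0]
  have h1 := hF.2 ![0, 1]
  rw [dotProduct_self_eq_nsq, wnorm_eq] at h0 h1
  simp [nsq] at h0 h1
  linarith

/-- A nearby comparison plan forces a solution to be near the desired motion, however large the
tracking weight may be. -/
lemma IsSolution.abs_err_le {P : Platoon N} (htree : P.HasSpanningTree) {t : ℕ}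
    {S : LoopState N} {W : Fin N → Decision P.Np} (hW : P.IsSolution t S W) {e : ℝ} (he : 0 ≤ e)
    (hx : ∀ i l, |S.x i l - P.des i t l| ≤ e)
    (ha : ∀ j, ∀ k ≤ P.Np, ∀ l, |P.aerr t S j k l| ≤ e)
    {i : Fin N} {u : Fin P.Np → ℝ} (hu : P.InputFeasible t S i u)
    (h1 : ∀ k ≤ P.Np, ∀ l, |P.err i t (S.x i) u k l| ≤ e)
    (h2 : ∀ k, |P.res i (S.x i) u k| ≤ e) {k : ℕ} (hk : k ≤ P.Np) (l : Fin 2) :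
    |P.err i t (S.x i) (W i).u k l| ≤
      (1 + 2 / P.dt) * ((2 * (4 + 2 * P.dt)) ^ P.Np * ((2 * (P.Np * (11 + 8 * N)) + 4) * e)) := by
  have hε := P.ε_pos
  have hd := P.dt_pos
  set F := (W i).F with hFdef
  have hF := hW.epsPosDef_F i
  rw [← hFdef] at hF
  set μ := F 0 0 + F 1 1 with hμdef
  have hμ : 2 * P.ε ≤ μ := two_mul_le_trace hF
  -- In units of the trace `μ`: 3 + 8N comes from the unit-weight cost of the comparison plan (using
  -- ε ≤ μ) and 8 from its tracking cost. Both sides of the comparison scale with `μ`, so the size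
  -- of `F` cancels.
  set B : ℝ := P.Np * (11 + 8 * N) with hB
  have hB0 : 0 ≤ B := by positivity
  set m := (2 * B + 4) * e with hm
  have hm0 : 0 ≤ m := by positivity
  set E := P.err i t (S.x i) (W i).u with hE
  have htrack : P.trackCost F t S i u ≤ P.Np * (μ * (8 * e ^ 2)) := by
    refine sum_range_le fun k hk => ?_
    have hk := hk.le
    refine (wnorm_le_trace_mul hε.le hF _).trans ?_
    exact mul_le_mul_of_nonneg_left (nsq_sub_le_of_abs_le (h1 k hk) (ha i k hk)) (by linarith)
  have hbase := P.baseCost_le h1 h2 ha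
  have hle := hW.le i hu
  rw [← hFdef] at hle
  have hsmall : ∀ k < P.Np, wnorm F (E k) ≤ m ^ 2 * μ := by
    intro k hk
    have a1 : wnorm F (E k - P.aerr t S i k) ≤ P.trackCost F t S i (W i).u :=
      Finset.single_le_sum (f := fun k => wnorm F (E k - P.aerr t S i k))
        (fun k _ => wnorm_nonneg hε.le hF _) (Finset.mem_range.2 hk)
    have a2 : P.ε * P.baseCost t S i u ≤ μ * (P.Np * ((3 + 8 * N) * e ^ 2)) :=
      mul_le_mul (by linarith) hbase (P.baseCost_nonneg _ _ _ _) (by linarith)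
    have a3 := mul_nonneg hε.le (P.baseCost_nonneg t S i (W i).u)
    have a4 := wnorm_add_le hε.le hF (E k - P.aerr t S i k) (P.aerr t S i k)
    rw [sub_add_cancel] at a4
    have a5 : wnorm F (P.aerr t S i k) ≤ μ * (2 * e ^ 2) :=
      (wnorm_le_trace_mul hε.le hF _).trans
        (mul_le_mul_of_nonneg_left (nsq_le (ha i k hk.le)) (by linarith))
    have a6 : wnorm F (E k) ≤ μ * ((2 * B + 4) * e ^ 2) := by
      rw [hB]
      linarith
    refine a6.trans ?_
    rw [mul_comm (m ^ 2), hm, mul_pow]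
    refine mul_le_mul_of_nonneg_left (mul_le_mul_of_nonneg_right ?_ (sq_nonneg e)) (by linarith)
    nlinarith
  have hem : e ≤ m := le_mul_of_one_le_left he (by linarith)
  have hterm : ∀ l, |E P.Np l| ≤ e := by
    intro l
    have := ((P.inputFeasible_iff htree t S i _).1 (hW i).1.1).2.1
    rw [hE, this]
    exact P.abs_target_le htree he (fun j => ha j P.Np le_rfl) i l
  have h00 : |E 0 0| ≤ m := by
    refine le_trans ?_ hem
    rw [hE, err_zero]
    exact hx i 0
  have hpos := abs_position_le hd (epsPosDef_mono hF hε.le) (by linarith : 0 < μ) (n := P.Np)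
    (e := E) (fun k _ => P.err_succ_zero i t _ _ k) hm0 h00 ((hterm 0).trans hem) hsmall
  set K := (2 * (4 + 2 * P.dt)) ^ P.Np
  have hK : m ≤ K * m := le_mul_of_one_le_left hm0 (one_le_pow₀ (by linarith))
  have hfin : K * m ≤ (1 + 2 / P.dt) * (K * m) :=
    le_mul_of_one_le_left (by linarith) (by have := div_pos two_pos hd; linarith)
  fin_cases l
  · exact (hpos k hk).trans hfin
  · rcases hk.lt_or_eq with hk | rfl
    · have a1 : E k 1 = (E (k + 1) 0 - E k 0) / P.dt := by
        rw [hE, err_succ_zero]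
        field_simp
        ring
      have a2 : |E k 1| ≤ (K * m + K * m) / P.dt := by
        rw [a1, abs_div, abs_of_pos hd]
        gcongr
        exact (abs_sub _ _).trans (add_le_add (hpos (k + 1) hk) (hpos k hk.le))
      refine a2.trans ?_
      have a3 : (1 + 2 / P.dt) * (K * m) = K * m + (K * m + K * m) / P.dt := by ring
      rw [a3]
      linarith
    · exact ((hterm 1).trans hem).trans (hK.trans hfin)

variable {P}

/-- Steer each vehicle to its terminal target, which is small as a mean of small errors. -/
lemma exists_near_feasible (htree : P.HasSpanningTree) (hNp : 3 ≤ P.Np)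
    (hu : ∀ i, (P.veh i).umin < P.drag i P.v0 ∧ P.drag i P.v0 < (P.veh i).umax)
    {η : ℝ} (hη : 0 < η) :
    ∃ δ > 0, ∀ (t : ℕ) (S : LoopState N), P.Near δ t S → ∀ i, ∃ u, P.InputFeasible t S i u ∧
      (∀ k ≤ P.Np, ∀ l, |P.err i t (S.x i) u k l| ≤ η) ∧ ∀ k, |P.res i (S.x i) u k| ≤ η := by
  obtain ⟨δ, hδ, h⟩ := exists_pos_forall (p := fun (i : Fin N) (δ : ℝ) =>
      ∀ (t : ℕ) (x : State) (y : Output),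
      (∀ l, |x l - P.des i t l| ≤ δ) → (∀ l, |y l| ≤ δ) →
      ∃ u : Fin P.Np → ℝ, (∀ k, u k ∈ Set.Icc (P.veh i).umin (P.veh i).umax) ∧
        P.err i t x u P.Np = y ∧
        P.pred i x u P.Np 2 = P.drag i (P.pred i x u P.Np 1) ∧
        (∀ k ≤ P.Np, ∀ l, |P.err i t x u k l| ≤ η) ∧ ∀ k, |P.res i x u k| ≤ η)
    (fun i a b hab h t x y hx hy => h t x y (fun l => (hx l).trans hab) fun l => (hy l).trans hab)
    (fun i => P.exists_steering hNp hu i hη)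
  refine ⟨δ, hδ, fun t S hS i => ?_⟩
  rw [P.near_iff hδ] at hS
  obtain ⟨u, h1, h2, h3, h4, h5⟩ := h i t (S.x i) (P.target t S i)
    (fun l => ((hS i).1 l).le) 
    (P.abs_target_le htree hδ.le (fun j l => ((hS j).2 _ le_rfl l).le) i)
  exact ⟨u, (P.inputFeasible_iff htree t S i u).2 ⟨h1, h2, h3⟩, h4, h5⟩

/-- Plans of solutions at states near the desired motion are near the desired motion. -/
lemma exists_near_abs_err_lt (htree : P.HasSpanningTree) (hNp : 3 ≤ P.Np)
    (hu : ∀ i, (P.veh i).umin < P.drag i P.v0 ∧ P.drag i P.v0 < (P.veh i).umax)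
    {η : ℝ} (hη : 0 < η) :
    ∃ δ > 0, ∀ (t : ℕ) (S : LoopState N) (W : Fin N → Decision P.Np), P.Near δ t S →
      P.IsSolution t S W → ∀ i, ∀ k ≤ P.Np, ∀ l, |P.err i t (S.x i) (W i).u k l| < η := by
  have hd := P.dt_pos
  set C : ℝ := (1 + 2 / P.dt) * ((2 * (4 + 2 * P.dt)) ^ P.Np * (2 * (P.Np * (11 + 8 * N)) + 4))
    with hC
  have hCpos : 0 < C := by positivity
  obtain ⟨δ, hδ, h⟩ := exists_near_feasible htree hNp hu (show 0 < η / (2 * C) by positivity)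
  have hmin : 0 < min δ (η / (2 * C)) := lt_min hδ (by positivity)
  refine ⟨min δ (η / (2 * C)), hmin, fun t S W hS hW i k hk l => ?_⟩
  obtain ⟨u, hu1, hu2, hu3⟩ := h t S (hS.mono (min_le_left _ _)) i
  have hS' := (P.near_iff (by positivity) t S).1 (hS.mono (min_le_right _ _))
  have := hW.abs_err_le htree (by positivity : 0 ≤ η / (2 * C)) (fun i l => ((hS' i).1 l).le)
    (fun j k hk l => ((hS' j).2 k hk l).le) hu1 hu2 hu3 hk l
  refine this.trans_lt ?_
  have e : (1 + 2 / P.dt) * ((2 * (4 + 2 * P.dt)) ^ P.Np *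
      ((2 * (P.Np * (11 + 8 * N)) + 4) * (η / (2 * C)))) = C * (η / (2 * C)) := by
    rw [hC]; ring
  rw [e, show C * (η / (2 * C)) = η / 2 by field_simp]
  linarith

lemma next_x (S : LoopState N) (W : Fin N → Decision P.Np) (i : Fin N) :
    (P.next S W).x i = P.pred i (S.x i) (W i).u 1 := rfl

lemma aerr_next (t : ℕ) (S : LoopState N) (W : Fin N → Decision P.Np) (i : Fin N) (k : ℕ) :
    P.aerr (t + 1) (P.next S W) i k = P.err i t (S.x i) (W i).u (k + 1) := by
  rw [aerr, err, add_assoc, add_comm 1 k]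
  rfl

lemma err_terminal_succ {i : Fin N} {t : ℕ} {x : State} {u : Fin P.Np → ℝ} {k : ℕ}
    (h : P.pred i x u k 2 = P.drag i (P.pred i x u k 1)) :
    P.err i t x u (k + 1) 1 = P.err i t x u k 1 := by
  rw [err_one, err_one, pred_succ_one, h]
  ring

/-- The successor state is near the desired motion if the plans are. -/
lemma exists_next_near (hNp : 3 ≤ P.Np) {e : ℝ} (he : 0 < e) :
    ∃ δ > 0, ∀ (t : ℕ) (S : LoopState N) (W : Fin N → Decision P.Np),
      (∀ i, P.InputFeasible t S i (W i).u) →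
      (∀ i, ∀ k ≤ P.Np, ∀ l, |P.err i t (S.x i) (W i).u k l| < δ) →
      P.Near e (t + 1) (P.next S W) := by
  have hd := P.dt_pos
  -- The torque error is a continuous function of two consecutive velocity errors, so no separate
  -- torque estimate is required.
  have hcont : ∀ i, ∃ δ > 0, ∀ a b : ℝ, |a| ≤ δ → |b| ≤ δ →
      |P.drag i (P.v0 + a) - P.drag i P.v0 + (b - a) / P.gain i| < e := by
    intro i
    have hf : Continuous fun z : ℝ × ℝ =>
        |P.drag i (P.v0 + z.1) - P.drag i P.v0 + (z.2 - z.1) / P.gain i| :=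
      ((((P.continuous_drag i).comp (by fun_prop)).sub continuous_const).add (by fun_prop)).abs
    have hev := hf.continuousAt (x := 0) |>.eventually_lt_const (u := e) (by simpa)
    obtain ⟨δ, hδ, h⟩ := Metric.nhds_basis_closedBall.eventually_iff.1 hev
    refine ⟨δ, hδ, fun a b ha hb => h (x := (a, b)) ?_⟩
    rw [mem_closedBall_zero_iff, norm_prod_le_iff]
    exact ⟨ha, hb⟩
  obtain ⟨δ, hδ, h⟩ := exists_pos_forall
    (fun i a b hab h x y hx hy => h x y (hx.trans hab) (hy.trans hab)) hcont
  -- The factor 1 + Δt pays for the one extra steady step beyond the horizon, in which the position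
  -- error grows by Δt times the velocity error.
  refine ⟨min δ (e / (1 + P.dt)), by positivity, fun t S W hS hE => ?_⟩
  have hEδ := fun i k hk l => (hE i k hk l).trans_le (min_le_left _ _)
  have hEe := fun i k hk l => (hE i k hk l).trans_le (min_le_right _ _)
  have hele : e / (1 + P.dt) ≤ e := div_le_self he.le (by linarith)
  rw [P.near_iff he]
  refine fun i => ⟨fun l => ?_, fun k hk l => ?_⟩
  · rw [next_x]
    fin_cases l
    · have := (hEe i 1 (by omega) 0).trans_le hele
      rwa [err_zero] at this
    · have := (hEe i 1 (by omega) 1).trans_le hele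
      rwa [err_one] at this
    · have := h i _ _ (hEδ i 1 (by omega) 1).le (hEδ i 2 (by omega) 1).le
      simp only [err_one, add_sub_cancel] at this
      simp only [Fin.reduceFinMk, des_two, pred_torque]
      convert this using 2
      ring
  · rw [aerr_next]
    rcases hk.lt_or_eq with hk | rfl
    · exact (hEe i (k + 1) hk l).trans_le hele
    · have h0 := hEe i P.Np le_rfl 0
      have h1 := hEe i P.Np le_rfl 1
      fin_cases l
      · simp only [Fin.zero_eta, err_succ_zero]
        refine (abs_add_le _ _).trans_lt ?_
        rw [abs_mul, abs_of_pos hd]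
        calc _ < e / (1 + P.dt) + P.dt * (e / (1 + P.dt)) := by gcongr
          _ = e := by field_simp
      · simp only [Fin.mk_one, err_terminal_succ (hS i).2.2]
        exact h1.trans_le hele

/-- Continuous dependence of the closed loop over finitely many steps. -/
lemma exists_near_of_near (htree : P.HasSpanningTree) (hNp : 3 ≤ P.Np)
    (hu : ∀ i, (P.veh i).umin < P.drag i P.v0 ∧ P.drag i P.v0 < (P.veh i).umax)
    (n : ℕ) {e : ℝ} (he : 0 < e) :
    ∃ δ > 0, ∀ S : ℕ → LoopState N, P.Near δ 0 (S 0) →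
      (∀ t < n, P.Step t (S t) (S (t + 1))) → P.Near e n (S n) := by
  induction n generalizing e with
  | zero => exact ⟨e, he, fun S h _ => h⟩
  | succ n ih =>
    obtain ⟨δ, hδ, h1⟩ := P.exists_next_near hNp he
    obtain ⟨δ', hδ', h2⟩ := exists_near_abs_err_lt htree hNp hu hδ
    obtain ⟨δ'', hδ'', h3⟩ := ih hδ'
    refine ⟨δ'', hδ'', fun S hS hstep => ?_⟩
    obtain ⟨W, hW, hn⟩ := hstep n (by omega)
    rw [hn]
    exact h1 n _ W (fun i => (hW i).1.1)
      (h2 n _ W (h3 S hS fun t ht => hstep t (by omega)) hW)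

end

section

variable {N : ℕ} (P : Platoon N)

/-! ### Terminal errors vanish after finitely many steps -/

/-- `S` is a closed-loop motion up to time `n`, generated by the joint solutions `W`. -/
def Run (S : ℕ → LoopState N) (W : ℕ → Fin N → Decision P.Np) (n : ℕ) : Prop :=
  ∀ t < n, P.IsSolution t (S t) (W t) ∧ S (t + 1) = P.next (S t) (W t)

variable {P}

lemma target_eq_zero (hdir : P.Unidirectional) {t : ℕ} {S : LoopState N} {i : Fin N}
    (h : ∀ j < i, P.aerr t S j P.Np = 0) : P.target t S i = 0 := by
  rw [target, Finset.sum_eq_zero, smul_zero]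
  intro a ha
  cases a with
  | none => rfl
  | some j => exact h j (hdir i j (show P.Edge (some j) i by simpa [sources] using ha))

/-- The sources of `i` are the leader or vehicles ahead, whose terminal errors vanished one step
earlier. Hence the plan of `i` ends at zero error, and its steady continuation stays there. -/
lemma Run.aerr_eq_zero {S : ℕ → LoopState N} {W : ℕ → Fin N → Decision P.Np} {n : ℕ}
    (hrun : P.Run S W n) (hdir : P.Unidirectional) (htree : P.HasSpanningTree) {t : ℕ}
    (ht : t ≤ n) {i : Fin N} (hi : (i : ℕ) < t) : P.aerr t (S t) i P.Np = 0 := by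
  induction t generalizing i with
  | zero => omega
  | succ t ih =>
    obtain ⟨hW, hS⟩ := hrun t (by omega)
    obtain ⟨-, h1, h2⟩ := (P.inputFeasible_iff htree t (S t) i _).1 (hW i).1.1
    rw [target_eq_zero hdir fun j hj => ih (by omega) (by have : (j : ℕ) < i := hj; omega)] at h1
    rw [hS, aerr_next]
    ext l
    fin_cases l
    · simp [err_succ_zero, h1]
    · simp [err_terminal_succ h2, h1]

lemma Run.err_eq_zero {S : ℕ → LoopState N} {W : ℕ → Fin N → Decision P.Np} {n : ℕ}
    (hrun : P.Run S W n) (hdir : P.Unidirectional) (htree : P.HasSpanningTree) {t : ℕ}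
    (ht : t < n) (htN : N ≤ t) (i : Fin N) : P.err i t ((S t).x i) (W t i).u P.Np = 0 := by
  rw [((P.inputFeasible_iff htree t (S t) i _).1 ((hrun t ht).1 i).1.1).2.1]
  exact target_eq_zero hdir fun j _ => hrun.aerr_eq_zero hdir htree ht.le (by omega)

/-! ### Boundedness of the plans that end in the desired motion -/

/-- For c ≠ 0 the quadratic term dominates at large `v`. A bound linear in `K` is needed to iterate
backward along the horizon. -/
lemma abs_le_of_abs_sub_mul_sq_le (c : ℝ) :
    ∃ C, 1 ≤ C ∧ ∀ v K : ℝ, 0 ≤ K → |v - c * v ^ 2| ≤ K → |v| ≤ C * (K + 1) := by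
  by_cases hc : c = 0
  · exact ⟨1, le_rfl, fun v K hK h => by simp [hc] at h; linarith⟩
  have hc' : 0 < |c| := abs_pos.2 hc
  refine ⟨1 / |c| + 1, by have := one_div_pos.2 hc'; linarith, fun v K hK h => ?_⟩
  have h1 : |c| * |v| ^ 2 ≤ K + |v| := by
    have : c * v ^ 2 = v - (v - c * v ^ 2) := by ring
    rw [← abs_pow, ← abs_mul, this]
    exact (abs_sub _ _).trans (by linarith)
  by_contra! hlt
  have h2 : (1 + |c|) * (K + 1) < |c| * |v| := by
    calc _ = |c| * ((1 / |c| + 1) * (K + 1)) := by field_simp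
      _ < _ := by gcongr
  have h3 : 1 < |v| := by
    refine lt_of_le_of_lt ?_ hlt
    have := one_div_pos.2 hc'
    nlinarith
  nlinarith [mul_pos (by linarith : 0 < |v| - 1)
    (by nlinarith [mul_nonneg hc'.le hK] : 0 < |c| * |v| - (1 + K))]

/-- With a = Δt/τ the torque obeys T' = (1 - a) T + a u with bounded u. For a ≠ 1 it is solved
backward from the known terminal torque; for a = 1 each later torque is an input, and only the
initial one needs the extra hypothesis. -/
lemma exists_torque_bound (i : Fin N) :
    ∃ M, 0 ≤ M ∧ ∀ (t : ℕ) (x : State) (u : Fin P.Np → ℝ),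
      (∀ k, u k ∈ Set.Icc (P.veh i).umin (P.veh i).umax) →
      (P.dt / (P.veh i).τ = 1 → |x 2| ≤ max |(P.veh i).umin| |(P.veh i).umax|) →
      P.err i t x u P.Np = 0 → P.pred i x u P.Np 2 = P.drag i (P.pred i x u P.Np 1) →
      ∀ k ≤ P.Np, |P.pred i x u k 2| ≤ M := by
  set B := max |(P.veh i).umin| |(P.veh i).umax| with hB
  have hB0 : 0 ≤ B := (abs_nonneg _).trans (le_max_left _ _)
  have ha : 0 < P.dt / (P.veh i).τ := div_pos P.dt_pos (P.veh i).τ_pos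
  set a := P.dt / (P.veh i).τ
  have hstep : ∀ (x : State) (u : Fin P.Np → ℝ) (k : Fin P.Np),
      P.pred i x u (k + 1) 2 = (1 - a) * P.pred i x u k 2 + a * u k := by
    intro x u k
    rw [pred_succ_two, res_of_lt]
    ring
  have hin : ∀ u : Fin P.Np → ℝ, (∀ k, u k ∈ Set.Icc (P.veh i).umin (P.veh i).umax) →
      ∀ k, |u k| ≤ B := fun u hu k => abs_le_max_abs_abs (hu k).1 (hu k).2
  by_cases h1 : a = 1
  · refine ⟨B, hB0, fun t x u hu hx _ _ k hk => ?_⟩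
    cases k with
    | zero => exact hx h1
    | succ k =>
      rw [hstep x u ⟨k, hk⟩, h1]
      simpa using hin u hu ⟨k, hk⟩
  · have hpos : 0 < |1 - a| := abs_pos.2 (sub_ne_zero.2 (Ne.symm h1))
    set c := (1 + a) / |1 - a| with hcdef
    have hc : 1 ≤ c := by
      rw [hcdef, one_le_div hpos]
      exact (abs_sub _ _).trans (by rw [abs_one, abs_of_pos ha])
    set m := max B |P.drag i P.v0| with hm
    refine ⟨(2 * c) ^ P.Np * m, by positivity, fun t x u hu _ he hT => ?_⟩
    refine abs_le_of_backward (σ := fun k => P.pred i x u k 2) hc (by positivity) ?_ fun k hk => ?_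
    · have hv : P.pred i x u P.Np 1 = P.v0 := by
        have := congrFun he 1
        rw [err_one] at this
        exact sub_eq_zero.1 this
      simp only [hT, hv]
      exact le_max_right _ _
    · have e1 : (1 - a) * P.pred i x u k 2 = P.pred i x u (k + 1) 2 - a * u ⟨k, hk⟩ := by
        rw [hstep x u ⟨k, hk⟩]
        ring
      have e2 : |1 - a| * |P.pred i x u k 2| ≤ |P.pred i x u (k + 1) 2| + a * m := by
        rw [← abs_mul, e1]
        refine (abs_sub _ _).trans ?_
        rw [abs_mul, abs_of_pos ha]
        gcongr
        exact (hin u hu _).trans (le_max_left _ _)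
      have e3 : |1 - a| * (c * (|P.pred i x u (k + 1) 2| + m)) =
          (1 + a) * (|P.pred i x u (k + 1) 2| + m) := by
        rw [hcdef]
        field_simp
      refine le_of_mul_le_mul_left (e2.trans ?_) hpos
      rw [e3]
      have p1 : 0 ≤ |P.pred i x u (k + 1) 2| := abs_nonneg _
      have p2 : 0 ≤ m := by positivity
      nlinarith [mul_nonneg ha.le p1]

/-- Backward from the terminal velocity `v0`: the next velocity and the bounded torque determine v -
cv² for the current velocity v, which bounds v itself. -/
lemma exists_velocity_bound (i : Fin N) :
    ∃ M, 0 ≤ M ∧ ∀ (t : ℕ) (x : State) (u : Fin P.Np → ℝ),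
      (∀ k, u k ∈ Set.Icc (P.veh i).umin (P.veh i).umax) →
      (P.dt / (P.veh i).τ = 1 → |x 2| ≤ max |(P.veh i).umin| |(P.veh i).umax|) →
      P.err i t x u P.Np = 0 → P.pred i x u P.Np 2 = P.drag i (P.pred i x u P.Np 1) →
      ∀ k ≤ P.Np, |P.pred i x u k 1| ≤ M := by
  obtain ⟨MT, hMT0, hMT⟩ := P.exists_torque_bound i
  have hg := P.gain_pos i
  obtain ⟨α, β, hαβ⟩ : ∃ α β, ∀ v, P.drag i v = α * v ^ 2 + β :=
    ⟨(P.veh i).r / (P.veh i).η * (P.veh i).CA,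
      (P.veh i).r / (P.veh i).η * ((P.veh i).m * P.g * (P.veh i).f), fun v => by
        unfold drag; ring⟩
  obtain ⟨C, hC, hCv⟩ := abs_le_of_abs_sub_mul_sq_le (P.gain i * α)
  set m := P.gain i * MT + P.gain i * |β| + 1 + |P.v0| with hm
  have hm0 : 0 ≤ m := by positivity
  refine ⟨(2 * C) ^ P.Np * m, by positivity, fun t x u hu hx he hT => ?_⟩
  have hTb := hMT t x u hu hx he hT
  refine abs_le_of_backward (σ := fun k => P.pred i x u k 1) hC hm0 ?_ fun k hk => ?_
  · have hv : P.pred i x u P.Np 1 = P.v0 := by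
      have := congrFun he 1
      rw [err_one] at this
      exact sub_eq_zero.1 this
    simp only [hv, hm]
    have : 0 ≤ P.gain i * MT + P.gain i * |β| := by positivity
    linarith
  · have e1 : P.pred i x u k 1 - P.gain i * α * P.pred i x u k 1 ^ 2 =
        P.pred i x u (k + 1) 1 - P.gain i * P.pred i x u k 2 + P.gain i * β := by
      rw [pred_succ_one, hαβ]
      ring
    have e2 : |P.pred i x u k 1 - P.gain i * α * P.pred i x u k 1 ^ 2| ≤
        |P.pred i x u (k + 1) 1| + P.gain i * MT + P.gain i * |β| := by
      rw [e1]
      refine (abs_add_le _ _).trans ?_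
      rw [abs_mul, abs_of_pos hg]
      gcongr
      refine (abs_sub _ _).trans ?_
      rw [abs_mul, abs_of_pos hg]
      gcongr
      exact hTb k hk.le
    refine (hCv _ _ (by positivity) e2).trans (mul_le_mul_of_nonneg_left ?_ (by linarith))
    rw [hm]
    linarith [abs_nonneg P.v0]

lemma sum_succ_le {n : ℕ} {f : ℕ → ℝ} (h0 : 0 ≤ f 0) (hn : f n = 0) :
    ∑ k ∈ Finset.range n, f (k + 1) ≤ ∑ k ∈ Finset.range n, f k := by
  have h1 := Finset.sum_range_succ' f n
  have h2 := Finset.sum_range_succ f n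
  linarith

/-- An excess input is a function of three consecutive velocities that vanishes when they agree, and
it is Lipschitz for bounded velocities. The errors at `P.Np` and one step later are zero, so the
shifted sums are no larger than the original one. -/
lemma exists_res_bound (i : Fin N) (M : ℝ) :
    ∃ C, 0 ≤ C ∧ ∀ (t : ℕ) (x : State) (u : Fin P.Np → ℝ),
      P.err i t x u P.Np = 0 → P.pred i x u P.Np 2 = P.drag i (P.pred i x u P.Np 1) →
      (∀ k ≤ P.Np, |P.pred i x u k 1| ≤ M) →
      ∑ k ∈ Finset.range P.Np, P.res i x u k ^ 2 ≤
        C * ∑ k ∈ Finset.range P.Np, nsq (P.err i t x u k) := by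
  have hg := P.gain_pos i
  have hd := P.dt_pos
  have hτ := (P.veh i).τ_pos
  set D := (P.veh i).r / (P.veh i).η * (P.veh i).CA with hD
  set C := 1 / P.gain i + (P.veh i).τ / P.dt * (|D| * (2 * |M|) + 2 / P.gain i) with hC
  have hC0 : 0 ≤ C := by positivity
  refine ⟨C ^ 2 * 9, by positivity, fun t x u he hT hv => ?_⟩
  set v := fun k => P.pred i x u k 1 with hvdef
  set e := fun k => P.err i t x u k 1 with hedef
  have hve : ∀ k l, v k - v l = e k - e l := fun k l => by
    simp only [hvdef, hedef, err_one]
    ring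
  have hres : ∀ k < P.Np, P.res i x u k ^ 2 ≤
      C ^ 2 * 3 * (nsq (P.err i t x u k) + nsq (P.err i t x u (k + 1)) +
        nsq (P.err i t x u (k + 1 + 1))) := by
    intro k hk
    set s := |e k| + |e (k + 1)| + |e (k + 1 + 1)| with hs
    have hdiff : ∀ k l, |v k - v l| ≤ |e k| + |e l| := fun k l => by
      rw [hve]
      exact abs_sub _ _
    have p0 : 0 ≤ |e k| := abs_nonneg _
    have p1 : 0 ≤ |e (k + 1)| := abs_nonneg _
    have p2 : 0 ≤ |e (k + 1 + 1)| := abs_nonneg _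
    have e1 : P.res i x u k = (v (k + 1) - v k) / P.gain i + (P.veh i).τ / P.dt *
        (D * (v (k + 1) + v k) * (v (k + 1) - v k) +
          ((v (k + 1 + 1) - v (k + 1)) - (v (k + 1) - v k)) / P.gain i) := by
      rw [res_eq, pred_torque P i x u k, pred_torque P i x u (k + 1), ← drag_sub P i]
      ring
    have b1 : |v (k + 1) - v k| ≤ s := (hdiff _ _).trans (by rw [hs]; linarith)
    have b2 : |v (k + 1 + 1) - v (k + 1)| ≤ s := (hdiff _ _).trans (by rw [hs]; linarith)
    have hs0 : 0 ≤ s := by positivity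
    have b3 : |v (k + 1) + v k| ≤ 2 * |M| := by
      refine (abs_add_le _ _).trans ?_
      have := hv k hk.le
      have := hv (k + 1) hk
      have := le_abs_self M
      simp only [hvdef]
      linarith
    have b4 : |P.res i x u k| ≤ C * s := by
      rw [e1]
      refine (abs_add_le _ _).trans ?_
      rw [abs_div, abs_of_pos hg, abs_mul, abs_of_pos (div_pos hτ hd)]
      have c1 : |D * (v (k + 1) + v k) * (v (k + 1) - v k) +
          ((v (k + 1 + 1) - v (k + 1)) - (v (k + 1) - v k)) / P.gain i| ≤
          |D| * (2 * |M|) * s + (s + s) / P.gain i := by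
        refine (abs_add_le _ _).trans ?_
        rw [abs_mul, abs_mul, abs_div, abs_of_pos hg]
        gcongr
        exact (abs_sub _ _).trans (add_le_add b2 b1)
      calc _ ≤ s / P.gain i +
            (P.veh i).τ / P.dt * (|D| * (2 * |M|) * s + (s + s) / P.gain i) := by gcongr
        _ = C * s := by rw [hC]; ring
    have b5 : P.res i x u k ^ 2 ≤ (C * s) ^ 2 :=
      sq_le_sq' (neg_le_of_abs_le b4) (le_of_abs_le b4)
    have b6 : s ^ 2 ≤ 3 * (e k ^ 2 + e (k + 1) ^ 2 + e (k + 1 + 1) ^ 2) := by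
      rw [← sq_abs (e k), ← sq_abs (e (k + 1)), ← sq_abs (e (k + 1 + 1)), hs]
      nlinarith [sq_nonneg (|e k| - |e (k + 1)|), sq_nonneg (|e k| - |e (k + 1 + 1)|),
        sq_nonneg (|e (k + 1)| - |e (k + 1 + 1)|)]
    have b7 : ∀ k, e k ^ 2 ≤ nsq (P.err i t x u k) := fun k => by
      simp only [hedef, nsq]
      linarith [sq_nonneg (P.err i t x u k 0)]
    rw [mul_pow] at b5
    refine b5.trans ?_
    rw [mul_assoc]
    gcongr
    linarith [b7 k, b7 (k + 1), b7 (k + 1 + 1)]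
  have hlast : P.err i t x u (P.Np + 1) = 0 := by
    ext l
    fin_cases l
    · simp [err_succ_zero, he]
    · simp [err_terminal_succ hT, he]
  have h0 : nsq 0 = 0 := by simp [nsq]
  have s1 := sum_succ_le (n := P.Np) (f := fun k => nsq (P.err i t x u k)) (nsq_nonneg _)
    (by simp [he, h0])
  have s2 := sum_succ_le (n := P.Np) (f := fun k => nsq (P.err i t x u (k + 1))) (nsq_nonneg _)
    (by simp [hlast, h0])
  refine (Finset.sum_le_sum fun k hk => hres k (Finset.mem_range.1 hk)).trans ?_
  rw [← Finset.mul_sum, Finset.sum_add_distrib, Finset.sum_add_distrib]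
  calc _ ≤ C ^ 2 * 3 * (3 * ∑ k ∈ Finset.range P.Np, nsq (P.err i t x u k)) := by
        gcongr
        linarith
    _ = _ := by ring

/-- Along a motion, the excess inputs are controlled by the output errors once all terminal errors
have vanished. -/
lemma exists_run_res_bound (hdir : P.Unidirectional) (htree : P.HasSpanningTree)
    (hNp : 3 ≤ P.Np) :
    ∃ C, 0 ≤ C ∧ ∀ (S : ℕ → LoopState N) (W : ℕ → Fin N → Decision P.Np) (n : ℕ),
      P.Run S W n → ∀ t, N + 1 ≤ t → t < n → ∀ i,
      ∑ k ∈ Finset.range P.Np, P.res i ((S t).x i) (W t i).u k ^ 2 ≤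
        C * ∑ k ∈ Finset.range P.Np, nsq (P.err i t ((S t).x i) (W t i).u k) := by
  have : ∀ i : Fin N, ∃ C, 0 ≤ C ∧ ∀ (S : ℕ → LoopState N) (W : ℕ → Fin N → Decision P.Np) (n : ℕ),
      P.Run S W n → ∀ t, N + 1 ≤ t → t < n →
      ∑ k ∈ Finset.range P.Np, P.res i ((S t).x i) (W t i).u k ^ 2 ≤
        C * ∑ k ∈ Finset.range P.Np, nsq (P.err i t ((S t).x i) (W t i).u k) := by
    intro i
    obtain ⟨M, -, hM⟩ := P.exists_velocity_bound i
    obtain ⟨C, hC0, hC⟩ := P.exists_res_bound i M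
    refine ⟨C, hC0, fun S W n hrun t htN ht => ?_⟩
    have he := hrun.err_eq_zero hdir htree ht (by omega) i
    have hin := ((hrun t ht).1 i).1.1
    refine hC t _ _ he hin.2.2 (hM t _ _ hin.1 (fun ha => ?_) he hin.2.2)
    -- At least one step has been made, so if Δt = τ the present torque is the previous, bounded
    -- input.
    obtain ⟨t, rfl⟩ : ∃ s, t = s + 1 := ⟨t - 1, by omega⟩
    obtain ⟨hW, hS⟩ := hrun t (by omega)
    have hb := (hW i).1.1.1 ⟨0, by omega⟩
    have := P.res_of_lt i ((S t).x i) (W t i).u ⟨0, by omega⟩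
    simp only at this
    rw [hS, next_x, show (1 : ℕ) = 0 + 1 from rfl, pred_succ_two, ha, this]
    ring_nf
    exact abs_le_max_abs_abs hb.1 hb.2
  choose C hC0 hC using this
  obtain ⟨K, hK⟩ := Finite.exists_le C
  refine ⟨max K 0, le_max_right _ _, fun S W n hrun t htN ht i =>
    (hC i S W n hrun t htN ht).trans ?_⟩
  gcongr
  · exact Finset.sum_nonneg fun _ _ => nsq_nonneg _
  · exact (hK i).trans (le_max_left _ _)

end

section

variable {N : ℕ} (P : Platoon N)

/-! ### Contraction along motions without terminal errors -/

variable {P}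

/-- The plan of the previous step, continued by steady motion. -/
noncomputable def shiftPlan (i : Fin N) (x : State) (u : Fin P.Np → ℝ) (k : Fin P.Np) : ℝ :=
  P.res i x u (k + 1) + P.drag i (P.pred i x u (k + 1) 1)

lemma pred_shiftPlan (i : Fin N) (x : State) (u : Fin P.Np → ℝ) {k : ℕ} (hk : k ≤ P.Np) :
    P.pred i (P.pred i x u 1) (shiftPlan i x u) k = P.pred i x u (k + 1) := by
  induction k with
  | zero => rfl
  | succ k ih =>
    have h := P.res_of_lt i (P.pred i x u 1) (shiftPlan i x u) ⟨k, hk⟩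
    simp only at h
    rw [pred_succ, h, sub_add_cancel, ih (by omega), shiftPlan]
    exact (P.pred_succ i x u (k + 1)).symm

lemma res_shiftPlan (i : Fin N) (x : State) (u : Fin P.Np → ℝ) {k : ℕ} (hk : k < P.Np) :
    P.res i (P.pred i x u 1) (shiftPlan i x u) k = P.res i x u (k + 1) := by
  have h := P.res_of_lt i (P.pred i x u 1) (shiftPlan i x u) ⟨k, hk⟩
  simp only at h
  rw [h, pred_shiftPlan i x u hk.le, shiftPlan, add_sub_cancel_right]

lemma err_shiftPlan (i : Fin N) (t : ℕ) (x : State) (u : Fin P.Np → ℝ) {k : ℕ}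
    (hk : k ≤ P.Np) :
    P.err i (t + 1) (P.pred i x u 1) (shiftPlan i x u) k = P.err i t x u (k + 1) := by
  rw [err, err, pred_shiftPlan i x u hk, add_assoc, add_comm 1 k]

/-- The tracking deviation of a plan with unit weight. -/
noncomputable def devCost (t : ℕ) (S : LoopState N) (i : Fin N) (u : Fin P.Np → ℝ) : ℝ :=
  ∑ k ∈ Finset.range P.Np, nsq (P.err i t (S.x i) u k - P.aerr t S i k)

/-- The size of a plan, with weights that make the shift a contraction. -/
noncomputable def planSize (t : ℕ) (S : LoopState N) (i : Fin N) (u : Fin P.Np → ℝ) : ℝ :=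
  ∑ k ∈ Finset.range P.Np, 2 ^ k * nsq (P.err i t (S.x i) u k)

lemma devCost_nonneg (t : ℕ) (S : LoopState N) (i : Fin N) (u : Fin P.Np → ℝ) :
    0 ≤ devCost t S i u :=
  Finset.sum_nonneg fun _ _ => nsq_nonneg _

lemma planSize_nonneg (t : ℕ) (S : LoopState N) (i : Fin N) (u : Fin P.Np → ℝ) :
    0 ≤ planSize t S i u :=
  Finset.sum_nonneg fun _ _ => mul_nonneg (by positivity) (nsq_nonneg _)

lemma sum_nsq_le_planSize (t : ℕ) (S : LoopState N) (i : Fin N) (u : Fin P.Np → ℝ) :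
    ∑ k ∈ Finset.range P.Np, nsq (P.err i t (S.x i) u k) ≤ planSize t S i u :=
  Finset.sum_le_sum fun _ _ => le_mul_of_one_le_left (nsq_nonneg _) (one_le_pow₀ one_le_two)

/-- Young's inequality. The factor 1 + γ must be close to 1, since it is only compensated by the
contraction of the plan size. -/
lemma nsq_sub_le_add {γ : ℝ} (hγ : 0 < γ) (x y z : Output) :
    nsq (x - z) ≤ (1 + γ) * nsq (x - y) + (1 + 1 / γ) * nsq (z - y) := by
  have key : ∀ a b : ℝ, (a - b) ^ 2 ≤ (1 + γ) * a ^ 2 + (1 + 1 / γ) * b ^ 2 := by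
    intro a b
    have : (1 + γ) * a ^ 2 + (1 + 1 / γ) * b ^ 2 - (a - b) ^ 2 = (γ * a + b) ^ 2 / γ := by
      field_simp
      ring
    have h2 : 0 ≤ (γ * a + b) ^ 2 / γ := by positivity
    linarith
  have h0 := key (x 0 - y 0) (z 0 - y 0)
  have h1 := key (x 1 - y 1) (z 1 - y 1)
  simp only [nsq, Pi.sub_apply]
  rw [show x 0 - z 0 = x 0 - y 0 - (z 0 - y 0) by ring,
    show x 1 - z 1 = x 1 - y 1 - (z 1 - y 1) by ring]
  linarith

/-- Decrease of the cost, by comparison with the shifted plan. -/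
lemma Run.baseCost_succ_le {S : ℕ → LoopState N} {W : ℕ → Fin N → Decision P.Np} {n : ℕ}
    (hrun : P.Run S W n) (hdir : P.Unidirectional) (htree : P.HasSpanningTree)
    (hu : ∀ i, (P.veh i).umin < P.drag i P.v0 ∧ P.drag i P.v0 < (P.veh i).umax)
    {t : ℕ} (htN : N ≤ t) (ht : t + 1 < n) (i : Fin N) {γ : ℝ} (hγ : 0 < γ) :
    P.baseCost (t + 1) (S (t + 1)) i (W (t + 1) i).u +
        devCost (t + 1) (S (t + 1)) i (W (t + 1) i).u ≤
      (1 + γ) * P.baseCost t (S t) i (W t i).u +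
        (1 + 1 / γ) * ∑ j ∈ P.inNbrs i, devCost t (S t) j (W t j).u := by
  have hε := P.ε_pos
  obtain ⟨hW, hS⟩ := hrun t (by omega)
  have hW' := (hrun (t + 1) ht).1
  have he : ∀ j, P.err j t ((S t).x j) (W t j).u P.Np = 0 :=
    hrun.err_eq_zero hdir htree (by omega) htN
  have hx : (S (t + 1)).x i = P.pred i ((S t).x i) (W t i).u 1 := by rw [hS, next_x]
  have ha : ∀ j k, P.aerr (t + 1) (S (t + 1)) j k = P.err j t ((S t).x j) (W t j).u (k + 1) := by
    intro j k
    rw [hS, aerr_next]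
  set c := shiftPlan i ((S t).x i) (W t i).u with hc
  have hTi := (hW i).1.1.2.2
  have hv : P.pred i ((S t).x i) (W t i).u P.Np 1 = P.v0 := by
    have := congrFun (he i) 1
    rw [err_one] at this
    exact sub_eq_zero.1 this
  have herr : ∀ k ≤ P.Np, P.err i (t + 1) ((S (t + 1)).x i) c k =
      P.err i t ((S t).x i) (W t i).u (k + 1) := by
    intro k hk
    rw [hx, hc, err_shiftPlan _ _ _ _ hk]
  have hfeas : P.InputFeasible (t + 1) (S (t + 1)) i c := by
    rw [P.inputFeasible_iff htree]
    refine ⟨fun k => ?_, ?_, ?_⟩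
    · rcases Nat.lt_or_ge (k + 1 : ℕ) P.Np with hk | hk
      · have := P.res_of_lt i ((S t).x i) (W t i).u ⟨k + 1, hk⟩
        simp only at this
        rw [hc, shiftPlan, this, sub_add_cancel]
        exact (hW i).1.1.1 _
      · have hk' : (k + 1 : ℕ) = P.Np := by omega
        rw [hc, shiftPlan, res_of_le _ _ _ _ hk, hk', hv, zero_add]
        exact ⟨(hu i).1.le, (hu i).2.le⟩
    · rw [target_eq_zero hdir fun j _ => hrun.aerr_eq_zero hdir htree (t := t + 1) (by omega)
        (by omega), herr _ le_rfl]
      ext l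
      fin_cases l
      · simp [err_succ_zero, he i]
      · simp [err_terminal_succ hTi, he i]
    · rw [hx, hc, pred_shiftPlan _ _ _ le_rfl, pred_torque, pred_succ_one _ _ _ _ (P.Np + 1)]
      have h1 : P.pred i ((S t).x i) (W t i).u (P.Np + 1) 2 =
          P.drag i (P.pred i ((S t).x i) (W t i).u (P.Np + 1) 1) := by
        rw [pred_succ_one, pred_succ_two, hTi, res_of_le _ _ _ _ le_rfl]
        ring_nf
      rw [h1]
      ring
  have hopt := hW'.le i hfeas
  -- The shifted plan is the vehicle's own assumed output, so it costs nothing however large the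
  -- newly chosen `F` is.
  have htrack0 : P.trackCost (W (t + 1) i).F (t + 1) (S (t + 1)) i c = 0 := by
    refine Finset.sum_eq_zero fun k hk => ?_
    rw [herr k (Finset.mem_range.1 hk).le, ha, sub_self, wnorm_vec_zero]
  have htrack : P.ε * devCost (t + 1) (S (t + 1)) i (W (t + 1) i).u ≤
      P.trackCost (W (t + 1) i).F (t + 1) (S (t + 1)) i (W (t + 1) i).u := by
    rw [devCost, Finset.mul_sum]
    refine Finset.sum_le_sum fun k _ => ?_
    rw [← dotProduct_self_eq_nsq]
    exact (hW'.epsPosDef_F i).2 _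
  have hcand : P.baseCost (t + 1) (S (t + 1)) i c ≤
      (1 + γ) * P.baseCost t (S t) i (W t i).u +
        (1 + 1 / γ) * ∑ j ∈ P.inNbrs i, devCost t (S t) j (W t j).u := by
    set f : ℕ → ℝ := fun k => P.pin i * nsq (P.err i t ((S t).x i) (W t i).u k) +
      P.res i ((S t).x i) (W t i).u k ^ 2 + ∑ j ∈ P.inNbrs i,
        nsq (P.err i t ((S t).x i) (W t i).u k - P.err j t ((S t).x j) (W t j).u k) with hf
    have h0 : nsq 0 = 0 := by simp [nsq]
    have hfpos : 0 ≤ f 0 := add_nonneg (add_nonneg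
      (mul_nonneg (P.pin_nonneg i) (nsq_nonneg _)) (sq_nonneg _))
      (Finset.sum_nonneg fun _ _ => nsq_nonneg _)
    have e1 : P.baseCost (t + 1) (S (t + 1)) i c = ∑ k ∈ Finset.range P.Np, f (k + 1) := by
      refine Finset.sum_congr rfl fun k hk => ?_
      have hk := Finset.mem_range.1 hk
      rw [herr k hk.le, hx, hc, res_shiftPlan _ _ _ hk]
      simp only [ha, hf]
    have e2 : f P.Np = 0 := by simp [hf, he, h0, res_of_le]
    rw [e1]
    refine (sum_succ_le hfpos e2).trans ?_
    have hswap : ∑ j ∈ P.inNbrs i, devCost t (S t) j (W t j).u = ∑ k ∈ Finset.range P.Np,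
        ∑ j ∈ P.inNbrs i, nsq (P.err j t ((S t).x j) (W t j).u k - P.aerr t (S t) j k) :=
      Finset.sum_comm
    rw [hswap, baseCost, Finset.mul_sum, Finset.mul_sum, ← Finset.sum_add_distrib]
    refine Finset.sum_le_sum fun k _ => ?_
    -- The shift is measured against the neighbours' plans, the old cost against their assumed
    -- outputs; the difference is the neighbours' deviation.
    have h1 : ∑ j ∈ P.inNbrs i,
        nsq (P.err i t ((S t).x i) (W t i).u k - P.err j t ((S t).x j) (W t j).u k) ≤
        (1 + γ) * ∑ j ∈ P.inNbrs i, nsq (P.err i t ((S t).x i) (W t i).u k - P.aerr t (S t) j k) +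
        (1 + 1 / γ) * ∑ j ∈ P.inNbrs i,
          nsq (P.err j t ((S t).x j) (W t j).u k - P.aerr t (S t) j k) := by
      rw [Finset.mul_sum, Finset.mul_sum, ← Finset.sum_add_distrib]
      exact Finset.sum_le_sum fun j _ => nsq_sub_le_add hγ _ _ _
    have h2 : 0 ≤ γ * (P.pin i * nsq (P.err i t ((S t).x i) (W t i).u k) +
        P.res i ((S t).x i) (W t i).u k ^ 2) :=
      mul_nonneg hγ.le (add_nonneg (mul_nonneg (P.pin_nonneg i) (nsq_nonneg _)) (sq_nonneg _))
    simp only [hf]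
    linarith
  rw [htrack0, add_zero] at hopt
  refine le_trans ?_ hcand
  refine le_of_mul_le_mul_left ?_ hε
  linarith

/-- Shifting by one index halves the weights 2^k, and nothing enters at the far end because the
terminal error is zero. Passing from the shifted to the new plan costs 3/2, whence 3/4. -/
lemma Run.planSize_succ_le {S : ℕ → LoopState N} {W : ℕ → Fin N → Decision P.Np} {n : ℕ}
    (hrun : P.Run S W n) (hdir : P.Unidirectional) (htree : P.HasSpanningTree)
    {t : ℕ} (htN : N ≤ t) (ht : t + 1 < n) (i : Fin N) :
    planSize (t + 1) (S (t + 1)) i (W (t + 1) i).u ≤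
      3 / 4 * planSize t (S t) i (W t i).u +
        3 * 2 ^ P.Np * devCost (t + 1) (S (t + 1)) i (W (t + 1) i).u := by
  obtain ⟨hW, hS⟩ := hrun t (by omega)
  have he := hrun.err_eq_zero hdir htree (by omega) htN i
  set f : ℕ → ℝ := fun k => 2 ^ k * nsq (P.err i t ((S t).x i) (W t i).u k) with hf
  have h0 : nsq 0 = 0 := by simp [nsq]
  have hs := sum_succ_le (f := f) (n := P.Np)
    (mul_nonneg (by positivity) (nsq_nonneg _)) (by simp [hf, he, h0])
  have hle : planSize (t + 1) (S (t + 1)) i (W (t + 1) i).u ≤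
      3 / 4 * ∑ k ∈ Finset.range P.Np, f (k + 1) +
        3 * 2 ^ P.Np * devCost (t + 1) (S (t + 1)) i (W (t + 1) i).u := by
    rw [planSize, devCost, Finset.mul_sum, Finset.mul_sum, ← Finset.sum_add_distrib]
    refine Finset.sum_le_sum fun k hk => ?_
    have hk := (Finset.mem_range.1 hk).le
    have ha : P.aerr (t + 1) (S (t + 1)) i k = P.err i t ((S t).x i) (W t i).u (k + 1) := by
      rw [hS, aerr_next]
    rw [ha]
    set x := P.err i (t + 1) ((S (t + 1)).x i) (W (t + 1) i).u k
    set y := P.err i t ((S t).x i) (W t i).u (k + 1) with hy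
    have h1 : nsq x ≤ 3 / 2 * nsq y + 3 * nsq (x - y) := by
      simp only [nsq, Pi.sub_apply]
      nlinarith [sq_nonneg (2 * x 0 - 3 * y 0), sq_nonneg (2 * x 1 - 3 * y 1)]
    have h2 : (2 : ℝ) ^ k ≤ 2 ^ P.Np := pow_le_pow_right₀ one_le_two hk
    have h3 := mul_le_mul_of_nonneg_right h2 (nsq_nonneg (x - y))
    have h4 := mul_le_mul_of_nonneg_left h1 (by positivity : (0 : ℝ) ≤ 2 ^ k)
    simp only [hf, pow_succ, ← hy]
    linarith
  refine hle.trans ?_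
  have : ∑ k ∈ Finset.range P.Np, f k = planSize t (S t) i (W t i).u := rfl
  linarith

/-- The excess inputs are controlled by the vehicle's own output errors; a neighbour's assumed error
is its plan error up to its deviation. -/
lemma exists_baseCost_bound (hdir : P.Unidirectional) (htree : P.HasSpanningTree)
    (hNp : 3 ≤ P.Np) :
    ∃ C, 0 ≤ C ∧ ∀ (S : ℕ → LoopState N) (W : ℕ → Fin N → Decision P.Np) (n : ℕ),
      P.Run S W n → ∀ t, N + 1 ≤ t → t < n → ∀ i,
      P.baseCost t (S t) i (W t i).u ≤ C * planSize t (S t) i (W t i).u +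
        4 * ∑ j ∈ P.inNbrs i, (planSize t (S t) j (W t j).u + devCost t (S t) j (W t j).u) := by
  obtain ⟨C, hC0, hC⟩ := exists_run_res_bound hdir htree hNp
  refine ⟨1 + C + 2 * N, by positivity, fun S W n hrun t htN ht i => ?_⟩
  have hres := hC S W n hrun t htN ht i
  have hq := sum_nsq_le_planSize t (S t) i (W t i).u
  have hq0 : 0 ≤ ∑ k ∈ Finset.range P.Np, nsq (P.err i t ((S t).x i) (W t i).u k) :=
    Finset.sum_nonneg fun _ _ => nsq_nonneg _
  have hpin : ∑ k ∈ Finset.range P.Np, P.pin i * nsq (P.err i t ((S t).x i) (W t i).u k) ≤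
      ∑ k ∈ Finset.range P.Np, nsq (P.err i t ((S t).x i) (W t i).u k) :=
    Finset.sum_le_sum fun k _ => mul_le_of_le_one_left (nsq_nonneg _) (P.pin_le_one i)
  have htri : ∀ a b c : Output, nsq (a - b) ≤ 2 * nsq a + 4 * (nsq c + nsq (c - b)) := by
    intro a b c
    simp only [nsq, Pi.sub_apply]
    nlinarith [sq_nonneg (a 0 + b 0), sq_nonneg (a 1 + b 1), sq_nonneg (2 * c 0 - b 0),
      sq_nonneg (2 * c 1 - b 1)]
  have hnb : ∑ k ∈ Finset.range P.Np, ∑ j ∈ P.inNbrs i,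
      nsq (P.err i t ((S t).x i) (W t i).u k - P.aerr t (S t) j k) ≤
      N * (2 * planSize t (S t) i (W t i).u) +
        4 * ∑ j ∈ P.inNbrs i, (planSize t (S t) j (W t j).u + devCost t (S t) j (W t j).u) := by
    rw [Finset.sum_comm]
    have h1 : ∀ j ∈ P.inNbrs i, ∑ k ∈ Finset.range P.Np,
        nsq (P.err i t ((S t).x i) (W t i).u k - P.aerr t (S t) j k) ≤
        2 * planSize t (S t) i (W t i).u +
          4 * (planSize t (S t) j (W t j).u + devCost t (S t) j (W t j).u) := by
      intro j _
      have h2 := sum_nsq_le_planSize t (S t) j (W t j).u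
      have h3 : ∑ k ∈ Finset.range P.Np,
          nsq (P.err i t ((S t).x i) (W t i).u k - P.aerr t (S t) j k) ≤
          2 * ∑ k ∈ Finset.range P.Np, nsq (P.err i t ((S t).x i) (W t i).u k) +
            4 * (∑ k ∈ Finset.range P.Np, nsq (P.err j t ((S t).x j) (W t j).u k) +
              devCost t (S t) j (W t j).u) := by
        rw [devCost, Finset.mul_sum, ← Finset.sum_add_distrib, Finset.mul_sum,
          ← Finset.sum_add_distrib]
        exact Finset.sum_le_sum fun k _ => htri _ _ _
      linarith
    refine (Finset.sum_le_sum h1).trans ?_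
    rw [Finset.sum_add_distrib, Finset.sum_const, nsmul_eq_mul, ← Finset.mul_sum]
    have := planSize_nonneg t (S t) i (W t i).u
    gcongr
    exact_mod_cast (Finset.card_le_univ _).trans (Fintype.card_fin N).le
  rw [baseCost, Finset.sum_add_distrib, Finset.sum_add_distrib]
  have := mul_le_mul_of_nonneg_left hq hC0
  linarith

/-! ### Lyapunov functions of a vehicle and of the platoon. -/

/-- Lyapunov function of a single vehicle. -/
noncomputable def vehLyap (t : ℕ) (S : LoopState N) (W : Fin N → Decision P.Np) (i : Fin N) : ℝ :=
  P.baseCost t S i (W i).u + 1 / (6 * 2 ^ P.Np) * planSize t S i (W i).u +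
    1 / 2 * devCost t S i (W i).u

lemma vehLyap_nonneg (t : ℕ) (S : LoopState N) (W : Fin N → Decision P.Np) (i : Fin N) :
    0 ≤ vehLyap t S W i := by
  have := P.baseCost_nonneg t S i (W i).u
  have := planSize_nonneg t S i (W i).u
  have := devCost_nonneg t S i (W i).u
  unfold vehLyap
  positivity

/-- The Lyapunov function of a vehicle contracts up to those of its information sources. -/
lemma exists_vehLyap_succ_le (hdir : P.Unidirectional) (htree : P.HasSpanningTree)
    (hNp : 3 ≤ P.Np)
    (hu : ∀ i, (P.veh i).umin < P.drag i P.v0 ∧ P.drag i P.v0 < (P.veh i).umax) :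
    ∃ ρ K : ℝ, 0 ≤ ρ ∧ ρ < 1 ∧ 0 ≤ K ∧
      ∀ (S : ℕ → LoopState N) (W : ℕ → Fin N → Decision P.Np) (n : ℕ),
      P.Run S W n → ∀ t, N + 1 ≤ t → t + 1 < n → ∀ i,
      vehLyap (t + 1) (S (t + 1)) (W (t + 1)) i ≤ ρ * vehLyap t (S t) (W t) i +
        K * ∑ j ∈ P.inNbrs i, vehLyap t (S t) (W t) j := by
  obtain ⟨C, hC0, hC⟩ := exists_baseCost_bound hdir htree hNp
  -- With this weight, the deviation produced by the plan size is exactly half of the deviation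
  -- gained in the cost inequality; the other half is the deviation term of the new Lyapunov
  -- function.
  set l : ℝ := 1 / (6 * 2 ^ P.Np) with hl
  have hl0 : 0 < l := by positivity
  have hl1 : 3 * 2 ^ P.Np * l = 1 / 2 := by
    rw [hl]
    field_simp
    norm_num
  have hl2 : l ≤ 1 := by
    rw [hl, div_le_one (by positivity)]
    have : (1 : ℝ) ≤ 2 ^ P.Np := one_le_pow₀ one_le_two
    linarith
  -- Writing (1 + γ)L = (1 - γ)L + 2γL, the excess 2γL must cost at most l/8 times the plan size,
  -- which leaves 7/8 ≤ 1 - γ of it.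
  set γ : ℝ := l / (16 * (C + 1)) with hγ
  have hγ0 : 0 < γ := by positivity
  have hγC : 16 * (γ * C) + 16 * γ = l := by
    rw [hγ]
    field_simp
  have hγCpos : 0 ≤ γ * C := by positivity
  have hγ8 : γ ≤ 1 / 8 := by linarith
  set K0 := 8 * γ + 1 + 1 / γ with hK0
  have hK0pos : 0 < K0 := by positivity
  refine ⟨1 - γ, K0 * (1 / l + 2), by linarith, by linarith, by positivity,
    fun S W n hrun t htN ht i => ?_⟩
  have h1 := hrun.baseCost_succ_le hdir htree hu (by omega : N ≤ t) ht i hγ0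
  have h2 := hrun.planSize_succ_le hdir htree (by omega : N ≤ t) ht i
  have h3 := hC S W n hrun t htN (by omega) i
  have hnb : ∑ j ∈ P.inNbrs i, (planSize t (S t) j (W t j).u + devCost t (S t) j (W t j).u) ≤
      (1 / l + 2) * ∑ j ∈ P.inNbrs i, vehLyap t (S t) (W t) j := by
    rw [Finset.mul_sum]
    refine Finset.sum_le_sum fun j _ => ?_
    have a1 := P.baseCost_nonneg t (S t) j (W t j).u
    have a2 := planSize_nonneg t (S t) j (W t j).u
    have a3 := devCost_nonneg t (S t) j (W t j).u
    have e : (1 / l + 2) * vehLyap t (S t) (W t) j =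
        (1 / l + 2) * P.baseCost t (S t) j (W t j).u +
        (1 + 2 * l) * planSize t (S t) j (W t j).u +
        (1 / (2 * l) + 1) * devCost t (S t) j (W t j).u := by
      rw [vehLyap, ← hl]
      field_simp
    rw [e]
    have p1 : 0 ≤ (1 / l + 2) * P.baseCost t (S t) j (W t j).u := by positivity
    have p2 : 0 ≤ 2 * l * planSize t (S t) j (W t j).u := by positivity
    have p3 : 0 ≤ 1 / (2 * l) * devCost t (S t) j (W t j).u := by positivity
    linarith
  have hdev : ∑ j ∈ P.inNbrs i, devCost t (S t) j (W t j).u ≤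
      ∑ j ∈ P.inNbrs i, (planSize t (S t) j (W t j).u + devCost t (S t) j (W t j).u) :=
    Finset.sum_le_sum fun j _ => by linarith [planSize_nonneg t (S t) j (W t j).u]
  have b1 := planSize_nonneg t (S t) i (W t i).u
  have b2 := devCost_nonneg t (S t) i (W t i).u
  rw [vehLyap, vehLyap, ← hl]
  set L := P.baseCost t (S t) i (W t i).u
  set L' := P.baseCost (t + 1) (S (t + 1)) i (W (t + 1) i).u
  set q := planSize t (S t) i (W t i).u
  set q' := planSize (t + 1) (S (t + 1)) i (W (t + 1) i).u
  set d := devCost t (S t) i (W t i).u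
  set d' := devCost (t + 1) (S (t + 1)) i (W (t + 1) i).u
  set X := ∑ j ∈ P.inNbrs i, (planSize t (S t) j (W t j).u + devCost t (S t) j (W t j).u)
  set Y := ∑ j ∈ P.inNbrs i, vehLyap t (S t) (W t) j
  have c1 : l * q' ≤ 3 / 4 * (l * q) + 1 / 2 * d' := by
    have := mul_le_mul_of_nonneg_left h2 hl0.le
    have e : l * (3 / 4 * q + 3 * 2 ^ P.Np * d') = 3 / 4 * (l * q) + (3 * 2 ^ P.Np * l) * d' := by
      ring
    rw [e, hl1] at this
    exact this
  have c2 : 2 * γ * L ≤ l / 8 * q + 8 * γ * X := by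
    have := mul_le_mul_of_nonneg_left h3 (by positivity : 0 ≤ 2 * γ)
    have e : 2 * (γ * C) * q ≤ l / 8 * q := mul_le_mul_of_nonneg_right (by linarith) b1
    linarith
  have c3 : (1 + 1 / γ) * ∑ j ∈ P.inNbrs i, devCost t (S t) j (W t j).u ≤ (1 + 1 / γ) * X :=
    mul_le_mul_of_nonneg_left hdev (by positivity)
  have c4 : K0 * X ≤ K0 * ((1 / l + 2) * Y) := mul_le_mul_of_nonneg_left hnb hK0pos.le
  have c5 : 0 ≤ (1 / 8 - γ) * (l * q) := mul_nonneg (by linarith) (by positivity)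
  have c6 : 0 ≤ (1 - γ) * (1 / 2 * d) := mul_nonneg (by linarith) (by positivity)
  rw [hK0] at c4 ⊢
  linarith

/-- Lyapunov function of the platoon, in which vehicles further back count less. -/
noncomputable def lyap (κ : ℝ) (t : ℕ) (S : LoopState N) (W : Fin N → Decision P.Np) : ℝ :=
  ∑ i : Fin N, κ ^ (i : ℕ) * vehLyap t S W i

/-- For j < i the weight κ^i is at most κ · κ^j, so all coupling terms together add at most K N κ to
the rate; κ is chosen to make this at most half of 1 - ρ. -/
lemma exists_lyap_succ_le (hdir : P.Unidirectional) (htree : P.HasSpanningTree)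
    (hNp : 3 ≤ P.Np)
    (hu : ∀ i, (P.veh i).umin < P.drag i P.v0 ∧ P.drag i P.v0 < (P.veh i).umax) :
    ∃ ρ κ : ℝ, 0 ≤ ρ ∧ ρ < 1 ∧ 0 < κ ∧
      ∀ (S : ℕ → LoopState N) (W : ℕ → Fin N → Decision P.Np) (n : ℕ),
      P.Run S W n → ∀ t, N + 1 ≤ t → t + 1 < n →
      lyap κ (t + 1) (S (t + 1)) (W (t + 1)) ≤ ρ * lyap κ t (S t) (W t) := by
  obtain ⟨ρ, K, hρ0, hρ1, hK, h⟩ := exists_vehLyap_succ_le hdir htree hNp hu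
  set κ : ℝ := (1 - ρ) / (2 * (K * N + 1)) with hκ
  have hKN : 0 ≤ K * N := by positivity
  have hκ0 : 0 < κ := div_pos (by linarith) (by positivity)
  have hκ1 : κ ≤ 1 := by
    rw [hκ, div_le_one (by positivity)]
    linarith
  have hκK : K * N * κ ≤ (1 - ρ) / 2 := by
    have e : (K * N + 1) * κ = (1 - ρ) / 2 := by
      rw [hκ]
      field_simp
    linarith
  refine ⟨ρ + K * N * κ, κ, by positivity, by linarith, hκ0, fun S W n hrun t htN ht => ?_⟩
  have h1 : lyap κ (t + 1) (S (t + 1)) (W (t + 1)) ≤ ∑ i : Fin N,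
      (ρ * (κ ^ (i : ℕ) * vehLyap t (S t) (W t) i) + K * κ *
        ∑ j : Fin N, κ ^ (j : ℕ) * vehLyap t (S t) (W t) j) := by
    refine Finset.sum_le_sum fun i _ => ?_
    have a1 : κ ^ (i : ℕ) * ∑ j ∈ P.inNbrs i, vehLyap t (S t) (W t) j ≤
        κ * ∑ j : Fin N, κ ^ (j : ℕ) * vehLyap t (S t) (W t) j := by
      rw [Finset.mul_sum, Finset.mul_sum]
      refine le_trans (Finset.sum_le_sum fun j hj => ?_)
        (Finset.sum_le_univ_sum_of_nonneg fun j => ?_)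
      · have hji : (j : ℕ) < i := hdir i j (by simpa [inNbrs] using hj)
        rw [← mul_assoc, ← pow_succ']
        exact mul_le_mul_of_nonneg_right (pow_le_pow_of_le_one hκ0.le hκ1 hji)
          (vehLyap_nonneg _ _ _ _)
      · exact mul_nonneg hκ0.le (mul_nonneg (by positivity) (vehLyap_nonneg _ _ _ _))
    have a2 := mul_le_mul_of_nonneg_left (h S W n hrun t htN ht i)
      (by positivity : 0 ≤ κ ^ (i : ℕ))
    have a3 := mul_le_mul_of_nonneg_left a1 hK
    linarith
  refine h1.trans (le_of_eq ?_)
  rw [Finset.sum_add_distrib, ← Finset.mul_sum, Finset.sum_const, Finset.card_univ,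
    Fintype.card_fin, nsmul_eq_mul, lyap]
  ring

end

section

variable {N : ℕ} (P : Platoon N)

/-! ### Asymptotic stability -/

variable {P}

lemma lyap_le_pow_mul {κ ρ : ℝ} (hρ : 0 ≤ ρ) {S : ℕ → LoopState N}
    {W : ℕ → Fin N → Decision P.Np} {n : ℕ}
    (h : ∀ t, N + 1 ≤ t → t + 1 < n →
      lyap κ (t + 1) (S (t + 1)) (W (t + 1)) ≤ ρ * lyap κ t (S t) (W t)) (m : ℕ)
    (hm : N + 1 + m < n) :
    lyap κ (N + 1 + m) (S (N + 1 + m)) (W (N + 1 + m)) ≤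
      ρ ^ m * lyap κ (N + 1) (S (N + 1)) (W (N + 1)) := by
  induction m with
  | zero => simp
  | succ m ih =>
    calc _ ≤ ρ * lyap κ (N + 1 + m) (S (N + 1 + m)) (W (N + 1 + m)) := h _ (by omega) hm
      _ ≤ ρ * (ρ ^ m * lyap κ (N + 1) (S (N + 1)) (W (N + 1))) :=
        mul_le_mul_of_nonneg_left (ih (by omega)) hρ
      _ = _ := by ring

lemma lyap_nonneg {κ : ℝ} (hκ : 0 ≤ κ) (t : ℕ) (S : LoopState N) (W : Fin N → Decision P.Np) :
    0 ≤ lyap κ t S W :=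
  Finset.sum_nonneg fun _ _ => mul_nonneg (by positivity) (vehLyap_nonneg _ _ _ _)

/-- Plans are bounded by the Lyapunov function. -/
lemma exists_err_sq_le_lyap {κ : ℝ} (hκ : 0 < κ) :
    ∃ C, 0 < C ∧ ∀ (t : ℕ) (S : LoopState N) (W : Fin N → Decision P.Np),
      (∀ i, P.err i t (S.x i) (W i).u P.Np = 0) → ∀ i, ∀ k ≤ P.Np, ∀ l,
      P.err i t (S.x i) (W i).u k l ^ 2 ≤ C * lyap κ t S W := by
  have : ∀ i : Fin N, ∃ C, 0 < C ∧ ∀ (t : ℕ) (S : LoopState N) (W : Fin N → Decision P.Np),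
      P.err i t (S.x i) (W i).u P.Np = 0 → ∀ k ≤ P.Np, ∀ l,
      P.err i t (S.x i) (W i).u k l ^ 2 ≤ C * lyap κ t S W := by
    intro i
    refine ⟨6 * 2 ^ P.Np / κ ^ (i : ℕ), by positivity, fun t S W he k hk l => ?_⟩
    have hpos := lyap_nonneg hκ.le t S W
    rcases hk.lt_or_eq with hk | rfl
    · have h1 : P.err i t (S.x i) (W i).u k l ^ 2 ≤ nsq (P.err i t (S.x i) (W i).u k) := by
        unfold nsq
        fin_cases l
        · exact le_add_of_nonneg_right (sq_nonneg _)
        · exact le_add_of_nonneg_left (sq_nonneg _)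
      have h2 : nsq (P.err i t (S.x i) (W i).u k) ≤ planSize t S i (W i).u :=
        (Finset.single_le_sum (f := fun k => nsq (P.err i t (S.x i) (W i).u k))
          (fun _ _ => nsq_nonneg _) (Finset.mem_range.2 hk)).trans (sum_nsq_le_planSize t S i _)
      have h3 : 1 / (6 * 2 ^ P.Np) * planSize t S i (W i).u ≤ vehLyap t S W i := by
        have := P.baseCost_nonneg t S i (W i).u
        have := devCost_nonneg t S i (W i).u
        unfold vehLyap
        linarith
      have h4 : κ ^ (i : ℕ) * vehLyap t S W i ≤ lyap κ t S W :=
        Finset.single_le_sum (f := fun i : Fin N => κ ^ (i : ℕ) * vehLyap t S W i)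
          (fun _ _ => mul_nonneg (by positivity) (vehLyap_nonneg _ _ _ _)) (Finset.mem_univ i)
      calc _ ≤ planSize t S i (W i).u := h1.trans h2
        _ = 6 * 2 ^ P.Np * (1 / (6 * 2 ^ P.Np) * planSize t S i (W i).u) := by field_simp
        _ ≤ 6 * 2 ^ P.Np * vehLyap t S W i := by gcongr
        _ = 6 * 2 ^ P.Np / κ ^ (i : ℕ) * (κ ^ (i : ℕ) * vehLyap t S W i) := by field_simp
        _ ≤ _ := by gcongr
    · rw [he]
      simp only [Pi.zero_apply, ne_eq, OfNat.ofNat_ne_zero, not_false_iff, zero_pow]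
      positivity
  choose C hC0 hC using this
  obtain ⟨K, hK⟩ := Finite.exists_le C
  refine ⟨max K 1, by positivity, fun t S W he i k hk l => (hC i t S W (he i) k hk l).trans ?_⟩
  exact mul_le_mul_of_nonneg_right ((hK i).trans (le_max_left _ _)) (lyap_nonneg hκ.le _ _ _)

/-- The Lyapunov function is bounded by plans and assumed outputs. -/
lemma exists_lyap_le (hdir : P.Unidirectional) (htree : P.HasSpanningTree)
    (hNp : 3 ≤ P.Np) {κ : ℝ} (hκ : 0 < κ) :
    ∃ C, 0 < C ∧ ∀ (S : ℕ → LoopState N) (W : ℕ → Fin N → Decision P.Np) (n : ℕ),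
      P.Run S W n → ∀ t, N + 1 ≤ t → t < n → ∀ e,
      (∀ i, ∀ k ≤ P.Np, ∀ l, |P.err i t ((S t).x i) (W t i).u k l| ≤ e) →
      (∀ i, ∀ k ≤ P.Np, ∀ l, |P.aerr t (S t) i k l| ≤ e) →
      lyap κ t (S t) (W t) ≤ C * e ^ 2 := by
  obtain ⟨C, hC0, hC⟩ := exists_baseCost_bound hdir htree hNp
  set q : ℝ := P.Np * (2 ^ P.Np * 2) with hq
  set d : ℝ := P.Np * 8 with hd
  set B : ℝ := C * q + 4 * (N * (q + d)) + 1 / (6 * 2 ^ P.Np) * q + 1 / 2 * d with hB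
  have hB0 : 0 ≤ B := by positivity
  refine ⟨∑ i : Fin N, κ ^ (i : ℕ) * B + 1, by positivity,
    fun S W n hrun t htN ht e he ha => ?_⟩
  have h1 : ∀ i, planSize t (S t) i (W t i).u ≤ q * e ^ 2 := by
    intro i
    have : planSize t (S t) i (W t i).u ≤ P.Np * (2 ^ P.Np * (2 * e ^ 2)) := by
      refine sum_range_le fun k hk => ?_
      have h2 : (2 : ℝ) ^ k ≤ 2 ^ P.Np := pow_le_pow_right₀ one_le_two hk.le
      exact mul_le_mul h2 (nsq_le (he i k hk.le)) (nsq_nonneg _) (by positivity)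
    rw [hq]
    linarith
  have h2 : ∀ i, devCost t (S t) i (W t i).u ≤ d * e ^ 2 := by
    intro i
    have : devCost t (S t) i (W t i).u ≤ P.Np * (8 * e ^ 2) :=
      sum_range_le fun k hk => nsq_sub_le_of_abs_le (he i k hk.le) (ha i k hk.le)
    rw [hd]
    linarith
  have h3 : ∀ i, ∑ j ∈ P.inNbrs i, (planSize t (S t) j (W t j).u + devCost t (S t) j (W t j).u) ≤
      N * (q + d) * e ^ 2 := by
    intro i
    refine (Finset.sum_le_univ_sum_of_nonneg fun j =>
      add_nonneg (planSize_nonneg _ _ _ _) (devCost_nonneg _ _ _ _)).trans ?_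
    refine (Finset.sum_le_card_nsmul _ _ ((q + d) * e ^ 2) fun j _ => ?_).trans (le_of_eq ?_)
    · linarith [h1 j, h2 j]
    · simp
      ring
  have h4 : ∀ i, vehLyap t (S t) (W t) i ≤ B * e ^ 2 := by
    intro i
    have a1 := hC S W n hrun t htN ht i
    have a2 := mul_le_mul_of_nonneg_left (h1 i) hC0
    have a3 := mul_le_mul_of_nonneg_left (h1 i) (by positivity : (0 : ℝ) ≤ 1 / (6 * 2 ^ P.Np))
    rw [vehLyap, hB]
    linarith [h2 i, h3 i]
  calc lyap κ t (S t) (W t) ≤ ∑ i : Fin N, κ ^ (i : ℕ) * (B * e ^ 2) :=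
        Finset.sum_le_sum fun i _ => mul_le_mul_of_nonneg_left (h4 i) (by positivity)
    _ = (∑ i : Fin N, κ ^ (i : ℕ) * B) * e ^ 2 := by
        rw [Finset.sum_mul]
        exact Finset.sum_congr rfl fun i _ => by ring
    _ ≤ _ := by
        rw [add_mul, one_mul]
        exact le_add_of_nonneg_right (sq_nonneg e)

lemma exists_run {S : ℕ → LoopState N} {n : ℕ} (h : ∀ t < n, P.Step t (S t) (S (t + 1))) :
    ∃ W, P.Run S W n := by
  have : ∀ t, ∃ W : Fin N → Decision P.Np,
      t < n → P.IsSolution t (S t) W ∧ S (t + 1) = P.next (S t) W := by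
    intro t
    by_cases ht : t < n
    · obtain ⟨W, hW⟩ := h t ht
      exact ⟨W, fun _ => hW⟩
    · exact ⟨fun i => P.minimalDecision i 0 0, fun h => absurd h ht⟩
  choose W hW using this
  exact ⟨W, hW⟩

lemma abs_lt_of_sq_le_of_lt {a b e : ℝ} (he : 0 < e) (h : a ^ 2 ≤ b) (hb : b < e ^ 2) :
    |a| < e :=
  abs_lt_of_sq_lt_sq (h.trans_lt hb) he.le

/-- Times below N + 3 are handled by continuous dependence. Later times use the Lyapunov function
from time N + 1 on: small plans and assumed outputs make it small there, it does not grow, and it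
bounds the plan that determines the next state. -/
lemma lyapunovStable (hdir : P.Unidirectional) (htree : P.HasSpanningTree)
    (hNp : 3 ≤ P.Np)
    (hu : ∀ i, (P.veh i).umin < P.drag i P.v0 ∧ P.drag i P.v0 < (P.veh i).umax) :
    P.LyapunovStable := by
  intro e he
  obtain ⟨ρ, κ, hρ0, hρ1, hκ, hcontr⟩ := exists_lyap_succ_le hdir htree hNp hu
  obtain ⟨C, hC0, hC⟩ := exists_err_sq_le_lyap (P := P) hκ
  obtain ⟨D, hD0, hD⟩ := exists_lyap_le hdir htree hNp hκ
  obtain ⟨a, ha, hnext⟩ := exists_next_near hNp he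
  obtain ⟨b, hb, hbsq⟩ : ∃ b > 0, C * (D * b ^ 2) < a ^ 2 := by
    refine ⟨a / √(C * D + 1), by positivity, ?_⟩
    rw [div_pow, Real.sq_sqrt (by positivity)]
    calc C * (D * (a ^ 2 / (C * D + 1))) = a ^ 2 * (C * D / (C * D + 1)) := by ring
      _ < a ^ 2 * 1 := by
        gcongr
        rw [div_lt_one (by positivity)]
        linarith
      _ = a ^ 2 := mul_one _
  obtain ⟨c, hc, hplan⟩ := exists_near_abs_err_lt htree hNp hu hb
  obtain ⟨δ₁, hδ₁, hnear₁⟩ := exists_near_of_near htree hNp hu (N + 1) (lt_min hb hc)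
  obtain ⟨δ₂, hδ₂, hnear₂⟩ := exists_pos_forall
    (p := fun (n : Fin (N + 3)) δ => ∀ S : ℕ → LoopState N, P.Near δ 0 (S 0) →
      (∀ t < (n : ℕ), P.Step t (S t) (S (t + 1))) → P.Near e n (S n))
    (fun _ _ _ hab h S hS => h S (hS.mono hab))
    (fun n => exists_near_of_near htree hNp hu n he)
  refine ⟨min δ₁ δ₂, lt_min hδ₁ hδ₂, fun S n hS hstep => ?_⟩
  rcases lt_or_ge n (N + 3) with hn | hn
  · exact hnear₂ ⟨n, hn⟩ S (hS.mono (min_le_right _ _)) hstep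
  obtain ⟨W, hrun⟩ := exists_run hstep
  have h1 := hnear₁ S (hS.mono (min_le_left _ _)) fun t ht => hstep t (by omega)
  have h2 := hplan (N + 1) _ _ (h1.mono (min_le_right _ _)) (hrun (N + 1) (by omega)).1
  have h3 := (P.near_iff hb _ _).1 (h1.mono (min_le_left _ _))
  have h4 := hD S W n hrun (N + 1) le_rfl (by omega) b (fun i k hk l => (h2 i k hk l).le)
    fun i k hk l => ((h3 i).2 k hk l).le
  obtain ⟨m, rfl⟩ : ∃ m, n = N + 1 + m + 1 := ⟨n - (N + 2), by omega⟩
  have h5 := lyap_le_pow_mul hρ0 (hcontr S W _ hrun) m (by omega)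
  have h6 := lyap_nonneg hκ.le (N + 1) (S (N + 1)) (W (N + 1))
  have h7 := h5.trans ((mul_le_of_le_one_left h6 (pow_le_one₀ hρ0 hρ1.le)).trans h4)
  obtain ⟨hW, hSn⟩ := hrun (N + 1 + m) (by omega)
  rw [hSn]
  refine hnext _ _ _ (fun i => (hW i).1.1) fun i k hk l => ?_
  refine abs_lt_of_sq_le_of_lt ha (hC _ _ _ (fun i =>
    hrun.err_eq_zero hdir htree (by omega) (by omega) i) i k hk l) (lt_of_le_of_lt ?_ hbsq)
  exact mul_le_mul_of_nonneg_left h7 hC0.le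

lemma attractive (hdir : P.Unidirectional) (htree : P.HasSpanningTree)
    (hNp : 3 ≤ P.Np)
    (hu : ∀ i, (P.veh i).umin < P.drag i P.v0 ∧ P.drag i P.v0 < (P.veh i).umax) :
    P.Attractive := by
  intro S hstep e he
  obtain ⟨ρ, κ, hρ0, hρ1, hκ, hcontr⟩ := exists_lyap_succ_le hdir htree hNp hu
  obtain ⟨C, hC0, hC⟩ := exists_err_sq_le_lyap (P := P) hκ
  obtain ⟨a, ha, hnext⟩ := exists_next_near hNp he
  choose W hW using hstep
  have hrun : ∀ n, P.Run S W n := fun n t _ => hW t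
  have hlim : Filter.Tendsto
      (fun m : ℕ => C * (ρ ^ m * lyap κ (N + 1) (S (N + 1)) (W (N + 1)))) Filter.atTop
      (nhds 0) := by
    simpa using ((tendsto_pow_atTop_nhds_zero_of_lt_one hρ0 hρ1).mul_const _).const_mul C
  obtain ⟨m₀, hm₀⟩ := Filter.eventually_atTop.1 (hlim.eventually_lt_const (pow_pos ha 2))
  refine Filter.eventually_atTop.2 ⟨N + 1 + m₀ + 1, fun n hn => ?_⟩
  obtain ⟨m, rfl, hm⟩ : ∃ m, n = N + 1 + m + 1 ∧ m₀ ≤ m := ⟨n - (N + 2), by omega, by omega⟩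
  have h5 := lyap_le_pow_mul hρ0 (hcontr S W _ (hrun (N + 1 + m + 1))) m (by omega)
  obtain ⟨hsol, hSn⟩ := hW (N + 1 + m)
  rw [hSn]
  refine hnext _ _ _ (fun i => (hsol i).1.1) fun i k hk l => ?_
  refine abs_lt_of_sq_le_of_lt ha (hC _ _ _ (fun i =>
    (hrun _).err_eq_zero hdir htree (Nat.lt_succ_self _) (by omega) i) i k hk l)
    (lt_of_le_of_lt ?_ (hm₀ m hm))
  exact mul_le_mul_of_nonneg_left h5 hC0.le

/-- Stability keeps the motion in the neighbourhood where the input constraints are feasible, and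
feasibility already yields a joint solution. -/
lemma recursivelySolvable (hdir : P.Unidirectional) (htree : P.HasSpanningTree)
    (hNp : 3 ≤ P.Np)
    (hu : ∀ i, (P.veh i).umin < P.drag i P.v0 ∧ P.drag i P.v0 < (P.veh i).umax) :
    P.RecursivelySolvable := by
  obtain ⟨e, he, h⟩ := exists_near_feasible htree hNp hu one_pos
  obtain ⟨δ, hδ, hstab⟩ := lyapunovStable hdir htree hNp hu e he
  refine ⟨δ, hδ, fun S n hS hstep => P.exists_isSolution n (S n) fun i => ?_⟩
  obtain ⟨u, hfeas, -⟩ := h n (S n) (hstab S n hS hstep) i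
  exact ⟨u, hfeas⟩

end

end Platoon

end Platooning

theorem proposition2 {N : ℕ} (P : Platooning.Platoon N)
    (hdir : P.Unidirectional)
    (htree : P.HasSpanningTree)
    (hNp : 3 ≤ P.Np)
    (hu : ∀ i, (P.veh i).umin < P.drag i P.v0 ∧ P.drag i P.v0 < (P.veh i).umax) :
    P.AsymptoticallyStable :=
  ⟨Platooning.Platoon.recursivelySolvable hdir htree hNp hu,
    Platooning.Platoon.lyapunovStable hdir htree hNp hu,
    Platooning.Platoon.attractive hdir htree hNp hu⟩
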